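/- All systems are finite-dimensional, $\mathcal H_d$ denotes a Hilbert space of dimension $d$, and for a state $\rho$ of a composite system $AB$, $\rho_A=\operatorname{tr}_B\rho$. A probability vector is a finite vector of positive components in decreasing order summing to one; $\mathcal E_d$ is the set of those with at most $d$ components (a subset of $\mathbb R^d$, by padding with zeros), and $\boldsymbol\lambda(\omega)$ is the vector of the nonzero eigenvalues of the state $\omega$ (with multiplicity) in decreasing order. A correlation monotone $C$ is a non-negative function of the states of all bipartite systems $AB$ that vanishes for product states and is nonincreasing under quantum operations performed on $A$ alone or on $B$ alone (possibly changing the dimension). A convex entanglement monotone $E$ is a non-negative convex function of the states of all bipartite systems that vanishes for separable states and is nonincreasing under transformations involving only local operations and classical communication. A state $\rho$ of $AB$ is classical-classical if $\rho=\sum_{i,j}p_{ij}|i\rangle_A\langle i|\otimes|j\rangle_B\langle j|$ with orthonormal states $|i\rangle_A$ of $A$, orthonormal states $|j\rangle_B$ of $B$, and probabilities $p_{ij}$ summing to one; it is strictly correlated if moreover $p_{ij}=p_i\delta_{ij}$. For any correlation monotone $C$, there is a real-valued function $\tilde f$ of the probability vectors, with $\tilde f(1)=0$, such that, for any classical-classical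 state $\rho$ of any $AB$, $$C(\rho)\le\tilde f[\boldsymbol\lambda(\rho_A)],$$ with equality when $\rho$ is strictly correlated. Moreover, for any convex entanglement monotone $E$ there are numbers $e_{d_1}$, depending only on $E$ and $d_1$, such that $e_{d_1}$ is the largest value of $E$ on the states on $\mathcal H_{d_1}\otimes\mathcal H_{d_2}$ whenever $1\le d_1\le d_2$, and the following holds for all $1\le d_1\le d_2$. Let $d=d_1d_2$, let $\mathcal H_{d_1}\otimes\mathcal H_{d_2}$ be the Hilbert space of $A$, and suppose that $\tilde f$ is continuous on $\mathcal E_d$. Then $\tilde f$ has a maximum $\tilde c_d$ on $\mathcal E_d$, and there is a nonincreasing function $\zeta_{d_1,d_2}$ on $[0,\tilde c_d]$ with $\zeta_{d_1,d_2}(0)=e_{d_1}$ such that: 1. for any system $B$ and any classical-classical state $\rho$ of $AB$, $C(\rho)\in[0,\tilde c_d]$ and $E(\rho_A)\le\zeta_{d_1,d_2}[C(\rho)]$; 2. for any $x\in[0,\tilde c_d]$ and $\eta>0$, there are a system $B$ and a classical-classical state $\rho$ of $AB$ such that $C(\rho)=x$ and $\zeta_{d_1,d_2}(x)-E(\rho_A)<\eta$;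 3. if $\tilde f(1/d,\ldots,1/d)=\tilde c_d$ and $\tilde f(\boldsymbol p)<\tilde c_d$ for any other $\boldsymbol p\in\mathcal E_d$, then $\zeta_{d_1,d_2}(\tilde c_d)=0$. -/

import Mathlib

open scoped ComplexOrder Kronecker Matrix

noncomputable section

namespace QCorr

/-! ### Ordered probability vectors -/

/-- A probability vector: finitely many positive components in decreasing order, summing to one.
It is stored as a sequence, the vector being padded with zeros on the right. -/
@[ext] structure ProbVec where
  /-- the components, padded with zeros -/
  val : ℕ → ℝ
  antitone : Antitone val
  nonneg : ∀ i, 0 ≤ val i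
  sum_eq_one : ∃ d : ℕ, (∀ i, d ≤ i → val i = 0) ∧ ∑ i ∈ Finset.range d, val i = 1

namespace ProbVec

/-- The topology of componentwise convergence; on vectors with at most `d` components it is
the Euclidean topology of `ℝ^d`. -/
instance : TopologicalSpace ProbVec := TopologicalSpace.induced ProbVec.val inferInstance

/-- The set `ℰ_d` of the probability vectors with no more than `d` components. -/
def atMost (d : ℕ) : Set ProbVec := {p | ∀ i, d ≤ i → p.val i = 0}

/-- The equally distributed vector `(1/d, …, 1/d)`. -/
def uniform (d : ℕ) (hd : 0 < d) : ProbVec where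
  val i := if i < d then 1 / (d : ℝ) else 0
  antitone := by
    intro i j hij
    dsimp only
    split_ifs with h1 h2 h2
    · exact le_rfl
    · omega
    · positivity
    · exact le_rfl
  nonneg i := by
    split_ifs <;> positivity
  sum_eq_one := by
    refine ⟨d, fun i hi => if_neg (not_lt.mpr hi), ?_⟩
    rw [Finset.sum_congr rfl fun i hi => if_pos (Finset.mem_range.mp hi)]
    have : (d : ℝ) ≠ 0 := by exact_mod_cast hd.ne'
    simp [this]

/-- The one-component probability vector `1`. -/
def one : ProbVec := uniform 1 Nat.one_pos

end ProbVec

/-! ### States of finite-dimensional systems -/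

/-- A state (density operator) of the system with Hilbert space `ℂ^n`. -/
@[ext] structure State (n : Type) [Fintype n] where
  /-- the density matrix -/
  mat : Matrix n n ℂ
  posSemidef : mat.PosSemidef
  trace_eq_one : mat.trace = 1

section

variable {n a b a' b' : Type} [Fintype n] [Fintype a] [Fintype b] [Fintype a'] [Fintype b']

open scoped Classical in
/-- The vector `λ(ω)` of the nonzero eigenvalues of `ω`, with multiplicity, in decreasing order. -/
def State.spectrum (ω : State n) : ProbVec where
  val i := if h : i < Fintype.card n then ω.posSemidef.isHermitian.eigenvalues₀ ⟨i, h⟩ else 0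
  antitone := by
    have hnn : ∀ j, 0 ≤ ω.posSemidef.isHermitian.eigenvalues₀ j := fun j => by
      have := ω.posSemidef.eigenvalues_nonneg
        ((Fintype.equivOfCardEq (Fintype.card_fin (Fintype.card n))) j)
      simpa [Matrix.IsHermitian.eigenvalues] using this
    intro i j hij
    dsimp only
    split_ifs with h1 h2 h2
    · exact ω.posSemidef.isHermitian.eigenvalues₀_antitone hij
    · omega
    · exact hnn _
    · exact le_rfl
  nonneg i := by
    split_ifs with h
    · have := ω.posSemidef.eigenvalues_nonneg
        ((Fintype.equivOfCardEq (Fintype.card_fin (Fintype.card n))) ⟨i, h⟩)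
      simpa [Matrix.IsHermitian.eigenvalues] using this
    · exact le_rfl
  sum_eq_one := by
    refine ⟨Fintype.card n, fun i hi => dif_neg (not_lt.mpr hi), ?_⟩
    rw [Finset.sum_range]
    have h1 := ω.posSemidef.isHermitian.trace_eq_sum_eigenvalues
    rw [ω.trace_eq_one] at h1
    have h2 : ∑ j, ω.posSemidef.isHermitian.eigenvalues j = 1 := by
      apply Complex.ofReal_injective
      push_cast
      exact h1.symm
    rw [← h2, ← (Fintype.equivOfCardEq (Fintype.card_fin (Fintype.card n))).sum_comp]
    refine Finset.sum_congr rfl fun j _ => ?_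
    simp [Matrix.IsHermitian.eigenvalues]

/-- The reduced state `ρ_A = tr_B ρ` of a state `ρ` of `AB`. -/
def State.reduceLeft (ρ : State (a × b)) : State a where
  mat := ∑ j : b, ρ.mat.submatrix (fun i => (i, j)) (fun i => (i, j))
  posSemidef := Matrix.posSemidef_sum _ fun j _ => ρ.posSemidef.submatrix _
  trace_eq_one := by
    rw [← ρ.trace_eq_one]
    simp only [Matrix.trace, Matrix.diag, Matrix.sum_apply, Matrix.submatrix_apply,
      Fintype.sum_prod_type]

/-- `ρ` is the product state `σ ⊗ τ` for some `σ` and `τ`. -/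
def IsProduct (ρ : State (a × b)) : Prop :=
  ∃ (σ : State a) (τ : State b), ρ.mat = σ.mat ⊗ₖ τ.mat

/-- `ρ` is separable: a mixture of product states. -/
def IsSeparable (ρ : State (a × b)) : Prop :=
  ∃ (r : ℕ) (w : Fin r → ℝ) (σ : Fin r → State a) (τ : Fin r → State b),
    (∀ k, 0 ≤ w k) ∧ ∑ k, w k = 1 ∧
      ρ.mat = ∑ k, (w k : ℂ) • ((σ k).mat ⊗ₖ (τ k).mat)

/-- The operator `|ψ⟩⟨ψ|`. -/
def ketbra (ψ : EuclideanSpace ℂ n) : Matrix n n ℂ := fun i j => ψ i * star (ψ j)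

/-- `ρ = ∑_{i,j} p_{ij} |i⟩_A⟨i| ⊗ |j⟩_B⟨j|` with orthonormal states `|i⟩_A` of `A`, orthonormal
states `|j⟩_B` of `B`, and probabilities `p_{ij}` summing to one. -/
def IsClassicalClassical (ρ : State (a × b)) : Prop :=
  ∃ (r s : ℕ) (u : Fin r → EuclideanSpace ℂ a) (v : Fin s → EuclideanSpace ℂ b)
    (p : Fin r → Fin s → ℝ),
    Orthonormal ℂ u ∧ Orthonormal ℂ v ∧ (∀ i j, 0 ≤ p i j) ∧ ∑ i, ∑ j, p i j = 1 ∧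
      ρ.mat = ∑ i, ∑ j, (p i j : ℂ) • (ketbra (u i) ⊗ₖ ketbra (v j))

/-- A strictly correlated classical-classical state: `p_{ij} = p_i δ_{ij}`, that is,
`ρ = ∑_i p_i |i⟩_A⟨i| ⊗ |i⟩_B⟨i|`. -/
def IsStrictlyCorrelated (ρ : State (a × b)) : Prop :=
  ∃ (r : ℕ) (u : Fin r → EuclideanSpace ℂ a) (v : Fin r → EuclideanSpace ℂ b)
    (p : Fin r → ℝ),
    Orthonormal ℂ u ∧ Orthonormal ℂ v ∧ (∀ i, 0 ≤ p i) ∧ ∑ i, p i = 1 ∧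
      ρ.mat = ∑ i, (p i : ℂ) • (ketbra (u i) ⊗ₖ ketbra (v i))

/-! ### Operations -/

open scoped Classical in
/-- The Kraus operators `K k : ℂ^a → ℂ^{a'}` define a quantum operation (they also describe
a measurement with outcomes `k`). -/
def IsKraus {κ : Type} [Fintype κ] (K : κ → Matrix a' a ℂ) : Prop :=
  ∑ k, (K k)ᴴ * K k = 1

open scoped Classical in
/-- The map `X ↦ (L ⊗ I) X (L ⊗ I)†`. -/
def actLeft (L : Matrix a' a ℂ) (X : Matrix (a × b) (a × b) ℂ) : Matrix (a' × b) (a' × b) ℂ :=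
  (L ⊗ₖ (1 : Matrix b b ℂ)) * X * (L ⊗ₖ (1 : Matrix b b ℂ))ᴴ

open scoped Classical in
/-- The map `X ↦ (I ⊗ L) X (I ⊗ L)†`. -/
def actRight (L : Matrix b' b ℂ) (X : Matrix (a × b) (a × b) ℂ) : Matrix (a × b') (a × b') ℂ :=
  ((1 : Matrix a a ℂ) ⊗ₖ L) * X * ((1 : Matrix a a ℂ) ⊗ₖ L)ᴴ

end

/-- Finite-round protocols of local operations and classical communication, as maps from operators
of the bipartite system `(a, b)` to operators of the bipartite system `(a', b')`: either nothing
is done, or one party performs a local quantum measurement on its system, which may change the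
dimension of the latter, and announces the outcome `k`, after which a protocol that depends on `k`
is followed. -/
inductive IsLOCC (a' b' : Type) [Fintype a'] [Fintype b'] :
    (a b : Type) → [Fintype a] → [Fintype b] →
      (Matrix (a × b) (a × b) ℂ → Matrix (a' × b') (a' × b') ℂ) → Prop
  | refl : IsLOCC a' b' a' b' id
  | left {a b a₁ κ : Type} [Fintype a] [Fintype b] [Fintype a₁] [Fintype κ]
      (K : κ → Matrix a₁ a ℂ) (hK : IsKraus K)
      (Φ : κ → Matrix (a₁ × b) (a₁ × b) ℂ → Matrix (a' × b') (a' × b') ℂ)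
      (hΦ : ∀ k, IsLOCC a' b' a₁ b (Φ k)) :
      IsLOCC a' b' a b (fun X => ∑ k, Φ k (actLeft (K k) X))
  | right {a b b₁ κ : Type} [Fintype a] [Fintype b] [Fintype b₁] [Fintype κ]
      (K : κ → Matrix b₁ b ℂ) (hK : IsKraus K)
      (Φ : κ → Matrix (a × b₁) (a × b₁) ℂ → Matrix (a' × b') (a' × b') ℂ)
      (hΦ : ∀ k, IsLOCC a' b' a b₁ (Φ k)) :
      IsLOCC a' b' a b (fun X => ∑ k, Φ k (actRight (K k) X))

/-! ### Monotones -/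

/-- A real-valued function of the states of all finite-dimensional bipartite systems. -/
abbrev BipartiteFunction : Type 1 :=
  ∀ (a b : Type) [Fintype a] [Fintype b], State (a × b) → ℝ

/-- A correlation monotone: a non-negative function of the states of bipartite systems that
vanishes for product states and is nonincreasing under local operations, performed on either
of the two systems. -/
structure IsCorrelationMonotone (C : BipartiteFunction) : Prop where
  nonneg : ∀ (a b : Type) [Fintype a] [Fintype b] (ρ : State (a × b)), 0 ≤ C a b ρ
  product : ∀ (a b : Type) [Fintype a] [Fintype b] (ρ : State (a × b)),
    IsProduct ρ → C a b ρ = 0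
  mono_left : ∀ (a b a' κ : Type) [Fintype a] [Fintype b] [Fintype a'] [Fintype κ]
    (K : κ → Matrix a' a ℂ), IsKraus K → ∀ (ρ : State (a × b)) (ρ' : State (a' × b)),
      ρ'.mat = ∑ k, actLeft (K k) ρ.mat → C a' b ρ' ≤ C a b ρ
  mono_right : ∀ (a b b' κ : Type) [Fintype a] [Fintype b] [Fintype b'] [Fintype κ]
    (K : κ → Matrix b' b ℂ), IsKraus K → ∀ (ρ : State (a × b)) (ρ' : State (a × b')),
      ρ'.mat = ∑ k, actRight (K k) ρ.mat → C a b' ρ' ≤ C a b ρ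

/-- A convex entanglement monotone: a non-negative function of the states of bipartite systems
that vanishes for separable states, is nonincreasing under state transformations involving only
local operations and classical communication, and is convex. -/
structure IsConvexEntanglementMonotone (E : BipartiteFunction) : Prop where
  nonneg : ∀ (a b : Type) [Fintype a] [Fintype b] (ρ : State (a × b)), 0 ≤ E a b ρ
  separable : ∀ (a b : Type) [Fintype a] [Fintype b] (ρ : State (a × b)),
    IsSeparable ρ → E a b ρ = 0
  mono : ∀ (a b a' b' : Type) [Fintype a] [Fintype b] [Fintype a'] [Fintype b']
    (Φ : Matrix (a × b) (a × b) ℂ → Matrix (a' × b') (a' × b') ℂ), IsLOCC a' b' a b Φ →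
      ∀ (ρ : State (a × b)) (ρ' : State (a' × b')), ρ'.mat = Φ ρ.mat → E a' b' ρ' ≤ E a b ρ
  convex : ∀ (a b : Type) [Fintype a] [Fintype b] (ρ₀ ρ₁ ρ : State (a × b)) (t : ℝ),
    0 ≤ t → t ≤ 1 → ρ.mat = ((1 - t : ℝ) : ℂ) • ρ₀.mat + (t : ℂ) • ρ₁.mat →
      E a b ρ ≤ (1 - t) * E a b ρ₀ + t * E a b ρ₁

end QCorr

end

/-! Correlation side. A strictly correlated state can be turned into any classical-classical state
with the same spectrum on `A` by local operations: `A` rotates the eigenvectors into the required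
ones, and `B` replaces its label `i` by `j` with the conditional probability of `j` given `i`
(`IsCorrelationMonotone.le_of_spectrum_eq`). Hence strictly correlated states with equal reduced
spectra have equal `C`. This common value is `f`, and it bounds `C` on all classical-classical
states. Every state of `A` is the reduction of a strictly correlated one: copy its eigenbasis.

Entanglement side. The maximum `e d₁` is attained at the maximally entangled state, from which every
other state arises by LOCC (`IsConvexEntanglementMonotone.le_maxEntangled`).

Trade-off. Let `ζ x` be the supremum of `E` over the states `ω` of `A` with `x ≤ f ω.spectrum`.
Monotonicity, the value at `0` and the bound are then immediate. Tightness requires states with `f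
ω.spectrum` exactly `x`. With the eigenbasis of `ω` fixed, `E` is convex and `f` of the spectrum
continuous on the simplex of eigenvalues, and `f` vanishes at the vertices. From any point a convex
function does not decrease in one of two opposite directions, so one can travel towards a vertex or
a smaller face until `f` equals `x`, without losing entanglement
(`exists_eq_and_le_of_convexOn_stdSimplex`). No continuity of `E` is needed. If only the uniform
spectrum maximises `f`, the supremum at `c` is over the maximally mixed state alone, which is
separable. -/

noncomputable section

namespace QCorr

set_option linter.unusedSectionVars false

section

variable {n a b a' b' ι κ : Type} [Fintype n] [Fintype a] [Fintype b] [Fintype a'] [Fintype b']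
  [Fintype ι] [Fintype κ]

/-! ### Rank-one operators -/

theorem ketbra_eq_vecMulVec (ψ : EuclideanSpace ℂ n) :
    ketbra ψ = Matrix.vecMulVec ψ (star ψ) := rfl

theorem posSemidef_ketbra (ψ : EuclideanSpace ℂ n) : (ketbra ψ).PosSemidef :=
  Matrix.posSemidef_vecMulVec_self_star _

theorem star_dotProduct_eq_inner (ψ φ : EuclideanSpace ℂ n) :
    star (ψ : n → ℂ) ⬝ᵥ φ = inner ℂ ψ φ := by
  rw [EuclideanSpace.inner_eq_star_dotProduct, dotProduct_comm]

theorem star_dotProduct_self {ψ : EuclideanSpace ℂ n} (hψ : ‖ψ‖ = 1) :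
    star (ψ : n → ℂ) ⬝ᵥ ψ = 1 := by
  rw [star_dotProduct_eq_inner, inner_self_eq_norm_sq_to_K, hψ]
  simp

theorem star_dotProduct_of_orthonormal [DecidableEq ι] {u : ι → EuclideanSpace ℂ n}
    (hu : Orthonormal ℂ u) (i j : ι) :
    star (u i : n → ℂ) ⬝ᵥ u j = if i = j then 1 else 0 := by
  rw [star_dotProduct_eq_inner, orthonormal_iff_ite.mp hu]

theorem trace_ketbra {ψ : EuclideanSpace ℂ n} (hψ : ‖ψ‖ = 1) : (ketbra ψ).trace = 1 := by
  rw [ketbra_eq_vecMulVec, Matrix.trace_vecMulVec, dotProduct_comm, star_dotProduct_self hψ]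

/-- The unitary matrix whose columns are the vectors of an orthonormal basis. -/
def basisMatrix (u : ι → EuclideanSpace ℂ n) : Matrix n ι ℂ := Matrix.of fun i k => u k i

theorem conjTranspose_basisMatrix_mul_self [DecidableEq ι] {u : ι → EuclideanSpace ℂ n}
    (hu : Orthonormal ℂ u) : (basisMatrix u)ᴴ * basisMatrix u = 1 := by
  ext i j
  rw [Matrix.one_apply, ← star_dotProduct_of_orthonormal hu]
  rfl

theorem basisMatrix_mul_conjTranspose_self [DecidableEq n]
    (u : OrthonormalBasis n ℂ (EuclideanSpace ℂ n)) :
    basisMatrix u * (basisMatrix u)ᴴ = 1 :=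
  mul_eq_one_comm.mp (conjTranspose_basisMatrix_mul_self u.orthonormal)

theorem sum_smul_ketbra_eq [DecidableEq ι] (u : ι → EuclideanSpace ℂ n) (c : ι → ℂ) :
    ∑ k, c k • ketbra (u k) = basisMatrix u * Matrix.diagonal c * (basisMatrix u)ᴴ := by
  ext i j
  rw [Matrix.mul_apply, Matrix.sum_apply]
  refine Finset.sum_congr rfl fun k _ => ?_
  simp [ketbra, basisMatrix, Matrix.mul_diagonal]
  ring

theorem sum_ketbra [DecidableEq n] (u : OrthonormalBasis n ℂ (EuclideanSpace ℂ n)) :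
    ∑ k, ketbra (u k) = 1 := by
  have := sum_smul_ketbra_eq u fun _ => 1
  simpa [Matrix.diagonal_one, basisMatrix_mul_conjTranspose_self] using this

/-- An orthonormal family extends to an orthonormal basis. -/
theorem exists_orthonormalBasis_extension {u : ι → EuclideanSpace ℂ n} (hu : Orthonormal ℂ u) :
    ∃ (U : OrthonormalBasis n ℂ (EuclideanSpace ℂ n)) (φ : ι ↪ n), ∀ i, U (φ i) = u i := by
  classical
  have hcard : Fintype.card ι ≤ Fintype.card n := by
    have := hu.linearIndependent.fintype_card_le_finrank
    simpa using this
  obtain ⟨φ⟩ := Function.Embedding.nonempty_of_card_le hcard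
  rcases isEmpty_or_nonempty ι with hι | hι
  · exact ⟨EuclideanSpace.basisFun n ℂ, φ, fun i => hι.elim i⟩
  let v : n → EuclideanSpace ℂ n := fun x => u (Function.invFun φ x)
  have hinv : ∀ i, Function.invFun φ (φ i) = i := Function.leftInverse_invFun φ.injective
  have hv : Orthonormal ℂ ((Set.range φ).domRestrict v) := by
    refine hu.comp (fun x : Set.range φ => Function.invFun φ x) ?_
    rintro ⟨_, i, rfl⟩ ⟨_, j, rfl⟩ h
    simp only [hinv] at h
    simp [h]
  obtain ⟨U, hU⟩ := hv.exists_orthonormalBasis_extension_of_card_eq (by simp)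
  refine ⟨U, φ, fun i => ?_⟩
  rw [hU _ ⟨i, rfl⟩]
  simp only [v, hinv]

/-! ### Spectra -/

theorem charpoly_sum_smul_ketbra [DecidableEq n] (u : OrthonormalBasis n ℂ (EuclideanSpace ℂ n))
    (l : n → ℝ) :
    (∑ k, (l k : ℂ) • ketbra (u k)).charpoly =
      ∏ k, (Polynomial.X - Polynomial.C (l k : ℂ)) := by
  rw [sum_smul_ketbra_eq u fun k => (l k : ℂ), Matrix.charpoly_mul_comm, ← mul_assoc,
    conjTranspose_basisMatrix_mul_self u.orthonormal, one_mul, Matrix.charpoly_diagonal]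

/-- Both sides are the sorted list of roots of the characteristic polynomial, and sorting leaves a
decreasing list unchanged. -/
theorem eigenvalues₀_eq_of_antitone [DecidableEq n]
    (u : OrthonormalBasis n ℂ (EuclideanSpace ℂ n)) {l : n → ℝ} {A : Matrix n n ℂ}
    (hA : A.IsHermitian) (h : A = ∑ k, (l k : ℂ) • ketbra (u k))
    (τ : Fin (Fintype.card n) ≃ n) (hτ : Antitone (l ∘ τ)) : hA.eigenvalues₀ = l ∘ τ := by
  rw [← List.ofFn_inj, ← hA.sort_roots_charpoly_eq_eigenvalues₀, h, charpoly_sum_smul_ketbra,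
    Polynomial.roots_prod _ _ (by simp [Finset.prod_ne_zero_iff, Polynomial.X_sub_C_ne_zero]),
    ← Finset.univ_map_equiv_to_embedding τ]
  simp only [Finset.map_val, Polynomial.roots_X_sub_C, Multiset.bind_singleton, Multiset.map_map]
  simp only [Fin.univ_val_map, Multiset.coe_sort, Function.comp_def]
  simp only [Equiv.coe_toEmbedding, RCLike.re_to_complex, Complex.ofReal_re]
  apply List.mergeSort_of_pairwise
  simp_rw [decide_eq_true_eq, ← List.sortedGE_iff_pairwise]
  exact hτ.sortedGE_ofFn

theorem exists_equiv_antitone (l : n → ℝ) :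
    ∃ τ : Fin (Fintype.card n) ≃ n, Antitone (l ∘ τ) := by
  classical
  let e := (Fintype.equivFin n).symm
  let g : Fin (Fintype.card n) → ℝ := fun i => -l (e i)
  refine ⟨(Tuple.sort g).trans e, fun i j hij => ?_⟩
  have := Tuple.monotone_sort g hij
  simpa [g] using this

/-- The sorting bijection `τ` is a parameter so that it can be held fixed while the weights vary, as
the continuity of the spectrum requires. -/
theorem State.spectrum_val_of_antitone (ω : State n)
    (u : OrthonormalBasis n ℂ (EuclideanSpace ℂ n)) {l : n → ℝ}
    (h : ω.mat = ∑ k, (l k : ℂ) • ketbra (u k))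
    (τ : Fin (Fintype.card n) ≃ n) (hτ : Antitone (l ∘ τ)) (i : ℕ) :
    ω.spectrum.val i = if h : i < Fintype.card n then l (τ ⟨i, h⟩) else 0 := by
  classical
  simp only [State.spectrum]
  split_ifs with hi
  · rw [← Function.comp_apply (f := l), ← eigenvalues₀_eq_of_antitone u _ h τ hτ]
  · rfl

theorem State.spectrum_val_of_card_le (ω : State n) {i : ℕ} (hi : Fintype.card n ≤ i) :
    ω.spectrum.val i = 0 := by
  simp [State.spectrum, hi]

theorem State.exists_eq_sum_smul_ketbra (ω : State n) :
    ∃ (u : OrthonormalBasis n ℂ (EuclideanSpace ℂ n)) (l : n → ℝ), (∀ k, 0 ≤ l k) ∧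
      ω.mat = ∑ k, (l k : ℂ) • ketbra (u k) := by
  classical
  have hA := ω.posSemidef.isHermitian
  refine ⟨hA.eigenvectorBasis, hA.eigenvalues, ω.posSemidef.eigenvalues_nonneg, ?_⟩
  rw [sum_smul_ketbra_eq]
  conv_lhs => rw [hA.spectral_theorem, Unitary.conjStarAlgAut_apply]
  rfl

/-- The nonzero coefficients of a combination of orthogonal projectors are matched with
the nonzero components of its spectrum. -/
theorem State.exists_injective_spectrum (ω : State n) {u : ι → EuclideanSpace ℂ n}
    (hu : Orthonormal ℂ u) {p : ι → ℝ} (h : ω.mat = ∑ i, (p i : ℂ) • ketbra (u i)) :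
    ∃ g : ι → ℕ, Function.Injective g ∧ (∀ i, ω.spectrum.val (g i) = p i) ∧
      ∀ k, ω.spectrum.val k ≠ 0 → k ∈ Set.range g := by
  classical
  obtain ⟨U, φ, hφ⟩ := exists_orthonormalBasis_extension hu
  let l : n → ℝ := Function.extend φ p 0
  have hl : ∀ i, l (φ i) = p i := fun i => φ.injective.extend_apply ..
  have hl' : ∀ x, x ∉ Set.range φ → l x = 0 := fun x hx => Function.extend_apply' _ _ _ hx
  have hω : ω.mat = ∑ k, (l k : ℂ) • ketbra (U k) := by
    rw [h]
    refine Fintype.sum_of_injective φ φ.injective _ _ (fun x hx => ?_) fun i => ?_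
    · simp [hl' x hx]
    · rw [hl, hφ]
  obtain ⟨τ, hτ⟩ := exists_equiv_antitone l
  have hs := ω.spectrum_val_of_antitone U hω τ hτ
  refine ⟨fun i => τ.symm (φ i), fun i j hij => ?_, fun i => ?_, fun k hk => ?_⟩
  · exact φ.injective (τ.symm.injective (Fin.ext hij))
  · simp [hs, hl]
  · rw [hs] at hk
    split_ifs at hk with hk'
    · by_contra hc
      refine hk (hl' _ ?_)
      rintro ⟨i, hi⟩
      exact hc ⟨i, by simp [hi]⟩
    · exact absurd rfl hk

end

section

variable {n a b a' b' ι κ : Type} [Fintype n] [Fintype a] [Fintype b] [Fintype a'] [Fintype b']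
  [Fintype ι] [Fintype κ]

/-! ### Local operations on combinations of product operators -/

theorem actLeft_kronecker (L : Matrix a' a ℂ) (X : Matrix a a ℂ) (Y : Matrix b b ℂ) :
    actLeft L (X ⊗ₖ Y) = (L * X * Lᴴ) ⊗ₖ Y := by
  classical
  simp only [actLeft, Matrix.conjTranspose_kronecker, Matrix.conjTranspose_one,
    ← Matrix.mul_kronecker_mul, Matrix.one_mul, Matrix.mul_one]

theorem actRight_kronecker (L : Matrix b' b ℂ) (X : Matrix a a ℂ) (Y : Matrix b b ℂ) :
    actRight L (X ⊗ₖ Y) = X ⊗ₖ (L * Y * Lᴴ) := by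
  classical
  simp only [actRight, Matrix.conjTranspose_kronecker, Matrix.conjTranspose_one,
    ← Matrix.mul_kronecker_mul, Matrix.one_mul, Matrix.mul_one]

theorem actLeft_sum (L : Matrix a' a ℂ) (X : ι → Matrix (a × b) (a × b) ℂ) :
    actLeft L (∑ i, X i) = ∑ i, actLeft L (X i) := by
  simp only [actLeft, Matrix.mul_sum, Matrix.sum_mul]

theorem actRight_sum (L : Matrix b' b ℂ) (X : ι → Matrix (a × b) (a × b) ℂ) :
    actRight L (∑ i, X i) = ∑ i, actRight L (X i) := by
  simp only [actRight, Matrix.mul_sum, Matrix.sum_mul]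

theorem sum_kronecker (X : ι → Matrix a a' ℂ) (Y : Matrix b b' ℂ) :
    (∑ i, X i) ⊗ₖ Y = ∑ i, X i ⊗ₖ Y := by
  ext ⟨i, i'⟩ ⟨j, j'⟩
  simp [Matrix.sum_apply, Finset.sum_mul]

theorem kronecker_sum (X : Matrix a a' ℂ) (Y : ι → Matrix b b' ℂ) :
    X ⊗ₖ (∑ i, Y i) = ∑ i, X ⊗ₖ Y i := by
  ext ⟨i, i'⟩ ⟨j, j'⟩
  simp [Matrix.sum_apply, Finset.mul_sum]

theorem sum_actLeft_kronecker {X : κ → Matrix a a ℂ} (Y : κ → Matrix b b ℂ)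
    (K : ι → Matrix a' a ℂ) {X' : κ → Matrix a' a' ℂ}
    (h : ∀ j, ∑ k, K k * X j * (K k)ᴴ = X' j) :
    ∑ k, actLeft (K k) (∑ j, X j ⊗ₖ Y j) = ∑ j, X' j ⊗ₖ Y j := by
  simp only [actLeft_sum, actLeft_kronecker]
  rw [Finset.sum_comm]
  simp only [← sum_kronecker, h]

theorem sum_actRight_kronecker (X : κ → Matrix a a ℂ) {Y : κ → Matrix b b ℂ}
    (K : ι → Matrix b' b ℂ) {Y' : κ → Matrix b' b' ℂ}
    (h : ∀ j, ∑ k, K k * Y j * (K k)ᴴ = Y' j) :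
    ∑ k, actRight (K k) (∑ j, X j ⊗ₖ Y j) = ∑ j, X j ⊗ₖ Y' j := by
  simp only [actRight_sum, actRight_kronecker]
  rw [Finset.sum_comm]
  simp only [← kronecker_sum, h]

/-- The quantum operation that measures in an orthonormal basis and, on outcome `x`, prepares
the state `w y` with probability `T x y`. -/
theorem exists_isKraus_of_basis (U : OrthonormalBasis n ℂ (EuclideanSpace ℂ n))
    {T : n → κ → ℝ} (hT : ∀ x y, 0 ≤ T x y) (hT1 : ∀ x, ∑ y, T x y = 1)
    {w : κ → EuclideanSpace ℂ a} (hw : ∀ y, ‖w y‖ = 1) :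
    ∃ K : n × κ → Matrix a n ℂ, IsKraus K ∧
      ∀ x, ∑ k, K k * ketbra (U x) * (K k)ᴴ = ∑ y, (T x y : ℂ) • ketbra (w y) := by
  classical
  have hsq : ∀ x y, ((√(T x y) : ℝ) : ℂ) * ((√(T x y) : ℝ) : ℂ) = (T x y : ℂ) := fun x y => by
    rw [← Complex.ofReal_mul, Real.mul_self_sqrt (hT x y)]
  -- The Kraus operators are `√(T x y) |w y⟩⟨U x|`. Completeness uses only that the `w y` are unit
  -- vectors and that the rows of `T` sum to one.
  refine ⟨fun k => ((√(T k.1 k.2) : ℝ) : ℂ) • Matrix.vecMulVec (w k.2) (star (U k.1)), ?_, ?_⟩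
  · rw [IsKraus, Fintype.sum_prod_type]
    convert sum_ketbra U using 2 with x
    simp only [Matrix.conjTranspose_smul, Matrix.conjTranspose_vecMulVec, star_star, RCLike.star_def,
      Complex.conj_ofReal, Matrix.smul_mul, Matrix.mul_smul, smul_smul,
      Matrix.vecMulVec_mul_vecMulVec, star_dotProduct_self (hw _), hsq]
    rw [← Finset.sum_smul]
    norm_cast
    rw [hT1]
    simp [ketbra_eq_vecMulVec]
  · intro x
    rw [Fintype.sum_prod_type, Finset.sum_eq_single x]
    · refine Finset.sum_congr rfl fun y _ => ?_
      simp only [Matrix.conjTranspose_smul, Matrix.conjTranspose_vecMulVec, star_star,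
        RCLike.star_def, Complex.conj_ofReal, Matrix.smul_mul, Matrix.mul_smul, smul_smul,
        ketbra_eq_vecMulVec, Matrix.vecMulVec_mul_vecMulVec,
        hsq]
      have hx : star (U x).ofLp ⬝ᵥ (U x).ofLp = 1 := star_dotProduct_self (U.orthonormal.1 x)
      rw [hx, one_smul]
      erw [hx]
      rw [one_smul]
    · intro z _ hz
      refine Finset.sum_eq_zero fun y _ => ?_
      simp only [Matrix.conjTranspose_smul, Matrix.conjTranspose_vecMulVec, star_star,
        Matrix.smul_mul, Matrix.mul_smul,
        ketbra_eq_vecMulVec, Matrix.vecMulVec_mul_vecMulVec,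
        star_dotProduct_of_orthonormal U.orthonormal, if_neg hz]
      simp
    · simp

theorem exists_isKraus_of_orthonormal {u : ι → EuclideanSpace ℂ n} (hu : Orthonormal ℂ u)
    [Nonempty κ] {T : ι → κ → ℝ} (hT : ∀ x y, 0 ≤ T x y) (hT1 : ∀ x, ∑ y, T x y = 1)
    {w : κ → EuclideanSpace ℂ a} (hw : ∀ y, ‖w y‖ = 1) :
    ∃ K : n × κ → Matrix a n ℂ, IsKraus K ∧
      ∀ i, ∑ k, K k * ketbra (u i) * (K k)ᴴ = ∑ y, (T i y : ℂ) • ketbra (w y) := by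
  classical
  obtain ⟨U, φ, hφ⟩ := exists_orthonormalBasis_extension hu
  obtain ⟨y₀⟩ := ‹Nonempty κ›
  -- Outside the given family any probability row will do; it only serves completeness.
  let S : n → κ → ℝ := Function.extend φ T fun _ => Pi.single y₀ 1
  have hS : ∀ x, (∀ y, 0 ≤ S x y) ∧ ∑ y, S x y = 1 := by
    intro x
    by_cases hx : ∃ i, φ i = x
    · obtain ⟨i, rfl⟩ := hx
      simp only [S, φ.injective.extend_apply]
      exact ⟨hT i, hT1 i⟩
    · simp only [S, Function.extend_apply' _ _ _ hx]
      refine ⟨fun y => ?_, by simp⟩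
      rw [Pi.single_apply]
      split_ifs <;> simp
  obtain ⟨K, hK, h⟩ := exists_isKraus_of_basis U (fun x => (hS x).1) (fun x => (hS x).2) hw
  refine ⟨K, hK, fun i => ?_⟩
  rw [← hφ, h]
  simp only [S, φ.injective.extend_apply]

/-! ### Correlation monotones on classical-classical states -/

variable {C : BipartiteFunction}

theorem sum_smul_posSemidef {X : ι → Matrix n n ℂ} (hX : ∀ i, (X i).PosSemidef) {p : ι → ℝ}
    (hp : ∀ i, 0 ≤ p i) : (∑ i, (p i : ℂ) • X i).PosSemidef :=
  Matrix.posSemidef_sum _ fun i _ => (hX i).smul (by exact_mod_cast hp i)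

/-- The state `∑ i, p i • |u i⟩⟨u i| ⊗ |v i⟩⟨v i|`. -/
def correlatedState {u : ι → EuclideanSpace ℂ a} {v : ι → EuclideanSpace ℂ b} {p : ι → ℝ}
    (hu : ∀ i, ‖u i‖ = 1) (hv : ∀ i, ‖v i‖ = 1) (hp : ∀ i, 0 ≤ p i) (hp1 : ∑ i, p i = 1) :
    State (a × b) where
  mat := ∑ i, (p i : ℂ) • (ketbra (u i) ⊗ₖ ketbra (v i))
  posSemidef := by
    classical
    exact sum_smul_posSemidef (fun i => (posSemidef_ketbra _).kronecker (posSemidef_ketbra _)) hp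
  trace_eq_one := by
    simp only [Matrix.trace_sum, Matrix.trace_smul, Matrix.trace_kronecker, trace_ketbra (hu _),
      trace_ketbra (hv _), mul_one, smul_eq_mul]
    exact_mod_cast hp1

/-- The label `i` is perfectly shared, so each party can process it alone: `A` re-prepares `u' i`,
and `B` draws `j` from the row `T i`. The vectors prepared need not be orthogonal. -/
theorem IsCorrelationMonotone.le_of_conditional (hC : IsCorrelationMonotone C) [Nonempty κ]
    {u : ι → EuclideanSpace ℂ a} (hu : Orthonormal ℂ u)
    {v : ι → EuclideanSpace ℂ b} (hv : Orthonormal ℂ v)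
    {p : ι → ℝ} (hp : ∀ i, 0 ≤ p i)
    {u' : ι → EuclideanSpace ℂ a'} (hu' : ∀ i, ‖u' i‖ = 1)
    {v' : κ → EuclideanSpace ℂ b'} (hv' : ∀ j, ‖v' j‖ = 1)
    {T : ι → κ → ℝ} (hT : ∀ i j, 0 ≤ T i j) (hT1 : ∀ i, ∑ j, T i j = 1)
    {ρ : State (a × b)} (hρ : ρ.mat = ∑ i, (p i : ℂ) • (ketbra (u i) ⊗ₖ ketbra (v i)))
    {ρ' : State (a' × b')}
    (hρ' : ρ'.mat = ∑ i, ∑ j, ((p i * T i j : ℝ) : ℂ) • (ketbra (u' i) ⊗ₖ ketbra (v' j))) :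
    C a' b' ρ' ≤ C a b ρ := by
  classical
  have hp1 : ∑ i, p i = 1 := by
    have h := ρ.trace_eq_one
    rw [hρ] at h
    simp only [Matrix.trace_sum, Matrix.trace_smul, Matrix.trace_kronecker,
      trace_ketbra (hu.1 _), trace_ketbra (hv.1 _), mul_one, smul_eq_mul] at h
    exact_mod_cast h
  have : Nonempty ι := by
    by_contra h
    rw [not_nonempty_iff] at h
    simp at hp1
  -- Intermediate state, after the operation on `A` and before that on `B`. The former is
  -- deterministic, so its transition matrix is the identity.
  let σ : State (a' × b) := correlatedState hu' hv.1 hp hp1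
  obtain ⟨K, hK, hK'⟩ := exists_isKraus_of_orthonormal hu (T := fun i j => (1 : Matrix ι ι ℝ) i j)
    (fun i j => by rw [Matrix.one_apply]; split_ifs <;> simp)
    (fun i => by simp [Matrix.one_apply]) hu'
  obtain ⟨M, hM, hM'⟩ := exists_isKraus_of_orthonormal hv hT hT1 hv'
  refine (hC.mono_right a' b b' _ M hM σ ρ' ?_).trans (hC.mono_left a b a' _ K hK ρ σ ?_)
  · have h := sum_actRight_kronecker (fun i => (p i : ℂ) • ketbra (u' i)) M hM'
    simp only [σ, correlatedState, ← Matrix.smul_kronecker]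
    rw [h, hρ']
    refine Finset.sum_congr rfl fun i _ => ?_
    rw [kronecker_sum]
    refine Finset.sum_congr rfl fun j _ => ?_
    rw [Matrix.smul_kronecker, Matrix.kronecker_smul, smul_smul]
    push_cast
    rfl
  · have h := sum_actLeft_kronecker (fun i => (p i : ℂ) • ketbra (v i)) K hK'
    simp only [σ, correlatedState, ← Matrix.kronecker_smul]
    rw [hρ]
    simp only [← Matrix.kronecker_smul]
    rw [h]
    refine Finset.sum_congr rfl fun i _ => ?_
    simp [Matrix.one_apply]

theorem State.reduceLeft_mat_of_sum (ρ : State (a × b)) {X : ι → Matrix a a ℂ}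
    {Y : ι → Matrix b b ℂ} (h : ρ.mat = ∑ i, X i ⊗ₖ Y i) :
    ρ.reduceLeft.mat = ∑ i, (Y i).trace • X i := by
  ext x y
  simp only [State.reduceLeft, h, Matrix.sum_apply, Matrix.submatrix_apply,
    Matrix.kroneckerMap_apply, Matrix.smul_apply, smul_eq_mul, Matrix.trace, Matrix.diag]
  rw [Finset.sum_comm]
  simp only [← Finset.mul_sum, mul_comm]

end

section

variable {n a b a' b' ι κ : Type} [Fintype n] [Fintype a] [Fintype b] [Fintype a'] [Fintype b']
  [Fintype ι] [Fintype κ] {C : BipartiteFunction}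

/-! ### Domination by strictly correlated states -/

theorem IsStrictlyCorrelated.isClassicalClassical {ρ : State (a × b)}
    (h : IsStrictlyCorrelated ρ) : IsClassicalClassical ρ := by
  obtain ⟨r, u, v, p, hu, hv, hp, hp1, hρ⟩ := h
  refine ⟨r, r, u, v, fun i j => if i = j then p i else 0, hu, hv, fun i j => ?_, by simpa, ?_⟩
  · dsimp only
    split_ifs
    exacts [hp i, le_rfl]
  · rw [hρ]
    refine Finset.sum_congr rfl fun i _ => ?_
    rw [Finset.sum_eq_single i]
    · simp
    · intro j _ hj
      simp [hj.symm]
    · simp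

/-- Among the classical-classical states with a given spectrum of the reduced state,
the strictly correlated ones are the most correlated. -/
theorem IsCorrelationMonotone.le_of_spectrum_eq (hC : IsCorrelationMonotone C)
    {ρ : State (a × b)} (hρ : IsClassicalClassical ρ) {σ : State (a' × b')}
    (hσ : IsStrictlyCorrelated σ) (h : ρ.reduceLeft.spectrum = σ.reduceLeft.spectrum) :
    C a b ρ ≤ C a' b' σ := by
  classical
  obtain ⟨r, s, u, v, P, hu, hv, hP, hP1, hρ⟩ := hρ
  obtain ⟨r', u', v', p, hu', hv', hp, hp1, hσ⟩ := hσ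
  have hσA : σ.reduceLeft.mat = ∑ i, (p i : ℂ) • ketbra (u' i) := by
    rw [σ.reduceLeft_mat_of_sum (X := fun i => (p i : ℂ) • ketbra (u' i))
      (Y := fun i => ketbra (v' i)) (by simp only [hσ, Matrix.smul_kronecker])]
    simp only [trace_ketbra (hv'.1 _), one_smul]
  have hρA : ρ.reduceLeft.mat = ∑ i, ((∑ j, P i j : ℝ) : ℂ) • ketbra (u i) := by
    rw [ρ.reduceLeft_mat_of_sum (X := fun i => ketbra (u i))
      (Y := fun i => ∑ j, (P i j : ℂ) • ketbra (v j))
      (by simp only [hρ, kronecker_sum, Matrix.kronecker_smul])]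
    simp only [Matrix.trace_sum, Matrix.trace_smul, trace_ketbra (hv.1 _), smul_eq_mul, mul_one,
      Complex.ofReal_sum]
  obtain ⟨g, hg, hgv, hgr⟩ := State.exists_injective_spectrum _ hu hρA
  obtain ⟨g', hg', hgv', hgr'⟩ := State.exists_injective_spectrum _ hu' hσA
  -- Equal spectra match the nonzero weights `p i` with nonzero marginals of `P`. Zero weights may
  -- have no partner, hence the subtype.
  have hm : ∀ i : {i : Fin r' // p i ≠ 0}, ∃ k, g k = g' i := fun i =>
    hgr _ (by rw [h, hgv']; exact i.2)
  choose m hm using hm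
  have hmi : Function.Injective m := fun i j hij =>
    Subtype.ext (hg' (by rw [← hm, ← hm, hij]))
  have hmv : ∀ i, ∑ j, P (m i) j = p i := fun i => by
    rw [← hgv, hm, h, hgv']
  -- Unmatched rows of `P` have zero marginal, hence vanish entrywise by nonnegativity.
  have hmr : ∀ k, k ∉ Set.range m → ∀ j, P k j = 0 := by
    intro k hk
    have h0 : ∑ j, P k j = 0 := by
      by_contra hne
      obtain ⟨i, hi⟩ := hgr' (g k) (by rw [← h, hgv]; exact hne)
      refine hk ⟨⟨i, ?_⟩, hg ?_⟩
      · rw [← hgv', hi, ← h, hgv]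
        exact hne
      · rw [hm, hi]
    intro j
    exact (Finset.sum_eq_zero_iff_of_nonneg fun j _ => hP k j).mp h0 j (Finset.mem_univ j)
  have : Nonempty (Fin s) := by
    by_contra hs
    rw [not_nonempty_iff] at hs
    simp at hP1
  refine hC.le_of_conditional (ι := {i : Fin r' // p i ≠ 0}) (u := fun i => u' i)
    (v := fun i => v' i) (p := fun i => p i) (u' := fun i => u (m i)) (v' := v)
    (T := fun i j => P (m i) j / p i) (hu'.comp _ Subtype.val_injective)
    (hv'.comp _ Subtype.val_injective) (fun i => hp i) (fun i => hu.1 _) hv.1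
    (fun i j => div_nonneg (hP _ _) (hp _)) (fun i => ?_) ?_ ?_
  · rw [← Finset.sum_div, hmv, div_self i.2]
  · rw [hσ]
    symm
    refine Fintype.sum_of_injective Subtype.val Subtype.val_injective _ _ (fun i hi => ?_)
      fun i => rfl
    have : p i = 0 := by simpa using hi
    simp [this]
  · rw [hρ]
    symm
    refine Fintype.sum_of_injective m hmi _ _ (fun i hi => ?_) fun i => ?_
    · simp [hmr i hi]
    · simp only [mul_div_cancel₀ _ i.2]

/-! ### Mixtures of the states of an orthonormal basis -/

/-- The state `∑ k, l k • |u k⟩⟨u k|`. -/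
def mixture (u : OrthonormalBasis n ℂ (EuclideanSpace ℂ n)) {l : n → ℝ}
    (hl : l ∈ stdSimplex ℝ n) : State n where
  mat := ∑ k, (l k : ℂ) • ketbra (u k)
  posSemidef := sum_smul_posSemidef (fun _ => posSemidef_ketbra _) hl.1
  trace_eq_one := by
    simp only [Matrix.trace_sum, Matrix.trace_smul, trace_ketbra (u.orthonormal.1 _), smul_eq_mul,
      mul_one]
    exact_mod_cast hl.2

theorem State.exists_eq_mixture (ω : State n) :
    ∃ (u : OrthonormalBasis n ℂ (EuclideanSpace ℂ n)) (l : n → ℝ) (hl : l ∈ stdSimplex ℝ n),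
      ω = mixture u hl := by
  obtain ⟨u, l, hl, h⟩ := ω.exists_eq_sum_smul_ketbra
  refine ⟨u, l, ⟨hl, ?_⟩, State.ext h⟩
  have h1 := ω.trace_eq_one
  simp only [h, Matrix.trace_sum, Matrix.trace_smul, trace_ketbra (u.orthonormal.1 _), smul_eq_mul,
    mul_one] at h1
  exact_mod_cast h1

/-! ### Probability vectors as reduced spectra -/

theorem State.spectrum_mem_atMost (ω : State n) :
    ω.spectrum ∈ ProbVec.atMost (Fintype.card n) := fun _ hi => ω.spectrum_val_of_card_le hi

theorem ProbVec.sum_range_eq_one {p : ProbVec} {d : ℕ} (hp : p ∈ atMost d) :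
    ∑ i ∈ Finset.range d, p.val i = 1 := by
  obtain ⟨m, hm, h1⟩ := p.sum_eq_one
  rw [← h1]
  rcases le_total d m with h | h
  · exact Finset.sum_subset (Finset.range_mono h) fun i _ hi => hp i (by simpa using hi)
  · exact (Finset.sum_subset (Finset.range_mono h) fun i _ hi => hm i (by simpa using hi)).symm

theorem exists_spectrum_eq {p : ProbVec} (hp : p ∈ ProbVec.atMost (Fintype.card n)) :
    ∃ ω : State n, ω.spectrum = p := by
  classical
  let e := Fintype.equivFin n
  let l : n → ℝ := fun k => p.val (e k)
  have hl : l ∈ stdSimplex ℝ n := by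
    refine ⟨fun k => p.nonneg _, ?_⟩
    rw [← ProbVec.sum_range_eq_one hp, Finset.sum_range]
    exact e.sum_comp fun i => p.val i
  refine ⟨mixture (EuclideanSpace.basisFun n ℂ) hl, ProbVec.ext (funext fun i => ?_)⟩
  rw [State.spectrum_val_of_antitone _ _ rfl e.symm
    (fun i j hij => by simpa [l] using p.antitone hij)]
  split_ifs with hi
  · simp [l]
  · exact (hp i (not_lt.mp hi)).symm

/-- A classical counterpart of purification: a copy of the system records which eigenvector occurs.
-/
theorem State.exists_isStrictlyCorrelated (ω : State n) :
    ∃ ρ : State (n × n), IsStrictlyCorrelated ρ ∧ ρ.reduceLeft = ω := by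
  obtain ⟨u, l, hl, rfl⟩ := ω.exists_eq_mixture
  refine ⟨correlatedState u.orthonormal.1 u.orthonormal.1 hl.1 hl.2, ?_, ?_⟩
  · let e := (Fintype.equivFin n).symm
    refine ⟨_, u ∘ e, u ∘ e, l ∘ e, u.orthonormal.comp _ e.injective,
      u.orthonormal.comp _ e.injective, fun _ => hl.1 _, ?_, ?_⟩
    · exact (e.sum_comp l).trans hl.2
    · exact (e.sum_comp fun i => (l i : ℂ) • (ketbra (u i) ⊗ₖ ketbra (u i))).symm
  · refine State.ext ?_
    rw [State.reduceLeft_mat_of_sum (X := fun i => (l i : ℂ) • ketbra (u i))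
      (Y := fun i => ketbra (u i)) _ (by simp only [correlatedState, Matrix.smul_kronecker])]
    simp only [trace_ketbra (u.orthonormal.1 _), one_smul]
    rfl

theorem ProbVec.exists_isStrictlyCorrelated (p : ProbVec) :
    ∃ (d : ℕ) (ρ : State (Fin d × Fin d)), IsStrictlyCorrelated ρ ∧ ρ.reduceLeft.spectrum = p := by
  obtain ⟨d, hd, -⟩ := p.sum_eq_one
  obtain ⟨ω, rfl⟩ := exists_spectrum_eq (n := Fin d) (p := p)
    (fun i hi => hd i (by simpa using hi))
  obtain ⟨ρ, hρ, rfl⟩ := ω.exists_isStrictlyCorrelated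
  exact ⟨d, ρ, hρ, rfl⟩

theorem ProbVec.eq_one_of_val_zero {p : ProbVec} (h : p.val 0 = 1) : p = one := by
  obtain ⟨d, hd, h1⟩ := p.sum_eq_one
  have hz : ∀ i, i ≠ 0 → p.val i = 0 := by
    intro i hi
    by_cases hid : d ≤ i
    · exact hd i hid
    have := Finset.sum_le_sum_of_subset_of_nonneg (f := p.val) (s := {0, i}) (t := Finset.range d)
      (by intro x hx; simp at hx ⊢; omega) (fun i _ _ => p.nonneg i)
    rw [Finset.sum_pair hi.symm, h1, h] at this
    linarith [p.nonneg i]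
  ext i
  by_cases hi : i = 0
  · subst hi
    simp [h, one, uniform]
  · simp [hz i hi, one, uniform, hi]

theorem ProbVec.val_le_one (p : ProbVec) (i : ℕ) : p.val i ≤ 1 := by
  obtain ⟨d, hd, h⟩ := p.sum_eq_one
  by_cases hid : d ≤ i
  · rw [hd i hid]
    exact zero_le_one
  · rw [← h]
    exact Finset.single_le_sum (fun i _ => p.nonneg i) (Finset.mem_range.mpr (not_le.mp hid))

theorem spectrum_mixture_single [DecidableEq n] (u : OrthonormalBasis n ℂ (EuclideanSpace ℂ n))
    (k : n) (hk : Pi.single k 1 ∈ stdSimplex ℝ n) : (mixture u hk).spectrum = ProbVec.one := by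
  obtain ⟨g, -, hg, -⟩ := (mixture u hk).exists_injective_spectrum u.orthonormal rfl
  apply ProbVec.eq_one_of_val_zero
  have h1 := hg k
  rw [Pi.single_eq_same] at h1
  refine le_antisymm (ProbVec.val_le_one _ _) ?_
  exact h1.symm.le.trans (ProbVec.antitone _ (Nat.zero_le _))

/-- The correlation of the classical-classical states is bounded by a function of the spectrum of
the reduced state, which is attained by the strictly correlated states. -/
theorem IsCorrelationMonotone.exists_spectral_bound (hC : IsCorrelationMonotone C) :
    ∃ f : ProbVec → ℝ, f ProbVec.one = 0 ∧ (∀ p, 0 ≤ f p) ∧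
      (∀ (a b : Type) [Fintype a] [Fintype b] (ρ : State (a × b)),
        IsClassicalClassical ρ → C a b ρ ≤ f ρ.reduceLeft.spectrum) ∧
      (∀ (a b : Type) [Fintype a] [Fintype b] (ρ : State (a × b)),
        IsStrictlyCorrelated ρ → C a b ρ = f ρ.reduceLeft.spectrum) := by
  choose d ρ hρ hs using ProbVec.exists_isStrictlyCorrelated
  -- The choice of `ρ p` is immaterial: strictly correlated states with equal reduced spectra
  -- dominate each other.
  let f : ProbVec → ℝ := fun p => C _ _ (ρ p)
  have hstrict : ∀ (a b : Type) [Fintype a] [Fintype b] (σ : State (a × b)),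
      IsStrictlyCorrelated σ → C a b σ = f σ.reduceLeft.spectrum := fun a b _ _ σ h =>
    le_antisymm (hC.le_of_spectrum_eq h.isClassicalClassical (hρ _) (hs _).symm)
      (hC.le_of_spectrum_eq (hρ _).isClassicalClassical h (hs _))
  refine ⟨f, ?_, fun p => hC.nonneg _ _ _, fun a b _ _ σ h =>
    hC.le_of_spectrum_eq h (hρ _) (hs _).symm, hstrict⟩
  -- For `f one = 0`, a one-dimensional system suffices: there the strictly correlated state is
  -- trivially a product.
  have hx : Pi.single (0 : Fin 1) 1 ∈ stdSimplex ℝ (Fin 1) := single_mem_stdSimplex ℝ _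
  let ω := mixture (EuclideanSpace.basisFun (Fin 1) ℂ) hx
  obtain ⟨σ, hσ, hσω⟩ := ω.exists_isStrictlyCorrelated
  have h0 := hstrict _ _ σ hσ
  rw [hσω, spectrum_mixture_single] at h0
  rw [← h0]
  refine hC.product _ _ _ ⟨ω, ω, ?_⟩
  have h1 : ω.mat = 1 := by
    have := sum_ketbra (EuclideanSpace.basisFun (Fin 1) ℂ)
    rw [← this]
    simp [ω, mixture]
  have h2 := σ.trace_eq_one
  ext ⟨i, i'⟩ ⟨j, j'⟩
  simp only [Matrix.trace, Matrix.diag, Fintype.sum_prod_type] at h2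
  simp only [Finset.univ_unique, Finset.sum_singleton] at h2
  rw [h1]
  simp only [Matrix.kroneckerMap_apply]
  rw [Subsingleton.elim i default, Subsingleton.elim i' default, Subsingleton.elim j default,
    Subsingleton.elim j' default, h2]
  simp

end

section

variable {n : Type} [Fintype n]

/-! ### Topology of the probability vectors -/

theorem ProbVec.isInducing_val : Topology.IsInducing ProbVec.val := ⟨rfl⟩

/-- The defining conditions are closed and place the vectors in the cube `[0,1]^ℕ`, compact by
Tychonoff. -/
theorem ProbVec.isCompact_atMost (d : ℕ) : IsCompact (atMost d) := by
  rw [isInducing_val.isCompact_iff]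
  have himage : ProbVec.val '' atMost d = {g : ℕ → ℝ | Antitone g} ∩ {g | ∀ i, 0 ≤ g i} ∩
      {g | ∀ i, d ≤ i → g i = 0} ∩ {g | ∑ i ∈ Finset.range d, g i = 1} := by
    ext g
    constructor
    · rintro ⟨p, hp, rfl⟩
      exact ⟨⟨⟨p.antitone, p.nonneg⟩, hp⟩, sum_range_eq_one hp⟩
    · rintro ⟨⟨⟨h1, h2⟩, h3⟩, h4⟩
      exact ⟨⟨g, h1, h2, d, h3, h4⟩, h3, rfl⟩
  rw [himage]
  have hK : IsCompact (Set.univ.pi fun _ : ℕ => Set.Icc (0 : ℝ) 1) :=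
    isCompact_univ_pi fun _ => isCompact_Icc
  refine hK.of_isClosed_subset ?_ ?_
  · refine ((IsClosed.inter ?_ ?_).inter ?_).inter ?_
    · simp only [Antitone, Set.ofPred_forall]
      exact isClosed_iInter fun i => isClosed_iInter fun j => isClosed_iInter fun _ =>
        isClosed_le (continuous_apply j) (continuous_apply i)
    · simp only [Set.ofPred_forall]
      exact isClosed_iInter fun i => isClosed_le continuous_const (continuous_apply i)
    · simp only [Set.ofPred_forall]
      exact isClosed_iInter fun i => isClosed_iInter fun _ =>
        isClosed_eq (continuous_apply i) continuous_const
    · exact isClosed_eq (continuous_finsetSum _ fun i _ => continuous_apply i) continuous_const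
  · rw [← himage]
    rintro _ ⟨p, -, rfl⟩ i -
    exact ⟨p.nonneg i, p.val_le_one i⟩

/-- Finitely many closed sets, one for each sorting bijection, cover the simplex. On each of them a
component of the spectrum is a fixed coordinate or zero, and the pieces glue. -/
theorem continuous_spectrum_mixture (u : OrthonormalBasis n ℂ (EuclideanSpace ℂ n)) :
    Continuous fun l : stdSimplex ℝ n => (mixture u l.2).spectrum := by
  rw [ProbVec.isInducing_val.continuous_iff, continuous_pi_iff]
  intro i
  let S : (Fin (Fintype.card n) ≃ n) → Set (stdSimplex ℝ n) := fun τ =>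
    {l | Antitone (l.1 ∘ τ)}
  have hcoord : ∀ k, Continuous fun l : stdSimplex ℝ n => l.1 k := fun k =>
    (continuous_apply k).comp continuous_subtype_val
  refine (locallyFinite_of_finite S).continuous ?_ (fun τ => ?_) fun τ => ?_
  · refine Set.eq_univ_of_forall fun l => Set.mem_iUnion.mpr ?_
    exact exists_equiv_antitone l.1
  · simp only [S, Antitone, Set.ofPred_forall]
    exact isClosed_iInter fun i => isClosed_iInter fun j => isClosed_iInter fun _ =>
      isClosed_le (hcoord _) (hcoord _)
  · refine ContinuousOn.congr (f := fun l : stdSimplex ℝ n =>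
      if h : i < Fintype.card n then l.1 (τ ⟨i, h⟩) else 0) ?_ fun l hl =>
        (mixture u l.2).spectrum_val_of_antitone u rfl τ hl i
    split_ifs with h
    · exact (hcoord _).continuousOn
    · exact continuousOn_const

/-! ### Level sets on a simplex -/

/-- A convex function on a segment is, on one of the two sides of a point of the segment,
at least as large as at this point. -/
theorem ConvexOn.le_left_or_le_right {V : Type*} [AddCommGroup V] [Module ℝ V] {s : Set V}
    {g : V → ℝ} (hg : ConvexOn ℝ s g) {x y z : V} (hx : x ∈ s) (hy : y ∈ s)
    (hz : z ∈ openSegment ℝ x y) :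
    (∀ w ∈ segment ℝ z x, g z ≤ g w) ∨ (∀ w ∈ segment ℝ z y, g z ≤ g w) := by
  by_contra! h
  obtain ⟨⟨w, hw, hgw⟩, ⟨w', hw', hgw'⟩⟩ := h
  have hzs : z ∈ s := hg.1.openSegment_subset hx hy hz
  have hws : w ∈ s := hg.1.segment_subset hzs hx hw
  have hws' : w' ∈ s := hg.1.segment_subset hzs hy hw'
  obtain ⟨a, b, ha, hb, hab, rfl⟩ := hz
  obtain ⟨α, β, hα, hβ, hαβ, rfl⟩ := hw
  obtain ⟨γ, δ, hγ, hδ, hγδ, rfl⟩ := hw'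
  set z := a • x + b • y with hz
  have hβ0 : 0 < β := by
    rcases hβ.eq_or_lt with rfl | h
    · simp only [add_zero] at hαβ
      simp [hαβ] at hgw
    · exact h
  have hδ0 : 0 < δ := by
    rcases hδ.eq_or_lt with rfl | h
    · simp only [add_zero] at hγδ
      simp [hγδ] at hgw'
    · exact h
  have hD : 0 < a * δ + b * β := by positivity
  -- Since `w - z = bβ (x - y)` and `w' - z = aδ (y - x)`, the weights `aδ` and `bβ` balance at `z`,
  -- so convexity contradicts both values lying below `g z`.
  have key : z = (a * δ / (a * δ + b * β)) • (α • z + β • x) +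
      (b * β / (a * δ + b * β)) • (γ • z + δ • y) := by
    have h1 : (a * δ + b * β) • z = (a * δ) • (α • z + β • x) + (b * β) • (γ • z + δ • y) := by
      have e1 : α = 1 - β := by linarith
      have e2 : γ = 1 - δ := by linarith
      have e3 : b = 1 - a := by linarith
      simp only [hz, e1, e2, e3]
      module
    rw [div_eq_inv_mul, div_eq_inv_mul, mul_smul _ (a * δ), mul_smul _ (b * β), ← smul_add, ← h1, smul_smul,
      inv_mul_cancel₀ hD.ne', one_smul]
  have p1 : 0 < a * δ / (a * δ + b * β) := by positivity
  have p2 : 0 < b * β / (a * δ + b * β) := by positivity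
  have p3 : a * δ / (a * δ + b * β) + b * β / (a * δ + b * β) = 1 := by field_simp
  have hlt := hg.2 hws hws' p1.le p2.le p3
  rw [← key] at hlt
  simp only [smul_eq_mul] at hlt
  have q1 := mul_lt_mul_of_pos_left hgw p1
  have q2 := mul_lt_mul_of_pos_left hgw' p2
  have q3 : g z = a * δ / (a * δ + b * β) * g z + b * β / (a * δ + b * β) * g z := by
    rw [← add_mul, p3, one_mul]
  linarith

/-- Let `F` be continuous on the simplex and at most `x` at its vertices. Then a point at which
`F` is at least `x` can be moved to one at which `F` equals `x`, without decreasing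
the convex function `g`. -/
theorem exists_eq_and_le_of_convexOn_stdSimplex [DecidableEq n] {g F : (n → ℝ) → ℝ}
    (hg : ConvexOn ℝ (stdSimplex ℝ n) g) (hF : ContinuousOn F (stdSimplex ℝ n)) {x : ℝ}
    (hFx : ∀ k, F (Pi.single k 1) ≤ x) :
    ∀ l ∈ stdSimplex ℝ n, x ≤ F l → ∃ m ∈ stdSimplex ℝ n, F m = x ∧ g l ≤ g m := by
  have hivt : ∀ l ∈ stdSimplex ℝ n, ∀ m ∈ stdSimplex ℝ n, x ≤ F l → F m ≤ x →
      ∃ w ∈ segment ℝ l m, F w = x := by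
    intro l hl m hm h1 h2
    have hsub : segment ℝ l m ⊆ stdSimplex ℝ n := (convex_stdSimplex ℝ n).segment_subset hl hm
    exact (convex_segment l m).isPreconnected.intermediate_value (right_mem_segment ℝ l m)
      (left_mem_segment ℝ l m) (hF.mono hsub) ⟨h2, h1⟩
  -- Induction on the size of the support, that is, on the dimension of the face containing `l` in
  -- its interior.
  suffices h : ∀ (N : ℕ), ∀ l ∈ stdSimplex ℝ n, (Finset.univ.filter fun k => l k ≠ 0).card = N →
      x ≤ F l → ∃ m ∈ stdSimplex ℝ n, F m = x ∧ g l ≤ g m from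
    fun l hl => h _ l hl rfl
  intro N
  induction N using Nat.strong_induction_on with
  | _ N ih =>
  intro l hl hN hxl
  obtain ⟨k, hk⟩ : ∃ k, l k ≠ 0 := by
    by_contra! h
    have := hl.2
    simp [h] at this
  have hlk0 : 0 < l k := lt_of_le_of_ne (hl.1 k) hk.symm
  have hvert : Pi.single k 1 ∈ stdSimplex ℝ n := single_mem_stdSimplex ℝ k
  have hsum : ∑ j ∈ Finset.univ.erase k, l j = 1 - l k := by
    rw [← hl.2, ← Finset.add_sum_erase _ _ (Finset.mem_univ k)]
    ring
  rcases (show l k ≤ 1 by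
    have : 0 ≤ ∑ j ∈ Finset.univ.erase k, l j := Finset.sum_nonneg fun j _ => hl.1 j
    linarith).eq_or_lt with h1 | h1
  · have hls : l = Pi.single k 1 := by
      ext j
      by_cases hj : j = k
      · subst hj
        simp [h1]
      · rw [h1, sub_self, Finset.sum_eq_zero_iff_of_nonneg fun j _ => hl.1 j] at hsum
        simp [hj, hsum j (by simp [hj])]
    refine ⟨l, hl, le_antisymm ?_ hxl, le_rfl⟩
    rw [hls]
    exact hFx k
  · have h1' : 0 < 1 - l k := by linarith
    -- The projection of `l` from the vertex `k` to the opposite face; `l` lies strictly between `m`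
    -- and that vertex.
    let m : n → ℝ := fun j => if j = k then 0 else l j / (1 - l k)
    have hm : m ∈ stdSimplex ℝ n := by
      refine ⟨fun j => ?_, ?_⟩
      · simp only [m]
        split_ifs
        · exact le_rfl
        · exact div_nonneg (hl.1 j) h1'.le
      · rw [← Finset.add_sum_erase _ _ (Finset.mem_univ k)]
        have : ∑ j ∈ Finset.univ.erase k, m j = ∑ j ∈ Finset.univ.erase k, l j / (1 - l k) :=
          Finset.sum_congr rfl fun j hj => by simp [m, Finset.ne_of_mem_erase hj]
        rw [this, ← Finset.sum_div, hsum, div_self h1'.ne']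
        simp [m]
    have hlm : l ∈ openSegment ℝ (Pi.single k 1) m := by
      refine ⟨l k, 1 - l k, hlk0, h1', by ring, ?_⟩
      ext j
      by_cases hj : j = k
      · subst hj
        simp [m]
      · simp [m, hj]
        field_simp
    have hmN : (Finset.univ.filter fun j => m j ≠ 0).card < N := by
      rw [← hN]
      refine Finset.card_lt_card ((Finset.ssubset_iff_of_subset fun j hj => ?_).mpr ⟨k, ?_, ?_⟩)
      · simp only [m, Finset.mem_filter, Finset.mem_univ, true_and] at hj ⊢
        intro h0
        simp [h0] at hj
      · simpa using hk
      · simp [m]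
    have hsub : ∀ w ∈ stdSimplex ℝ n, segment ℝ l w ⊆ stdSimplex ℝ n := fun w hw =>
      (convex_stdSimplex ℝ n).segment_subset hl hw
    -- Move in the direction in which `g` stays at least `g l`. If `F` does not come down to `x`
    -- before `m`, continue from `m`, whose support is smaller.
    rcases ConvexOn.le_left_or_le_right hg hvert hm hlm with h | h
    · obtain ⟨w, hw, hFw⟩ := hivt l hl _ hvert hxl (hFx k)
      exact ⟨w, hsub _ hvert hw, hFw, h w hw⟩
    · rcases le_total (F m) x with hmx | hmx
      · obtain ⟨w, hw, hFw⟩ := hivt l hl _ hm hxl hmx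
        exact ⟨w, hsub _ hm hw, hFw, h w hw⟩
      · obtain ⟨w, hw, hFw, hgw⟩ := ih _ hmN m hm rfl hmx
        exact ⟨w, hw, hFw, (h m (right_mem_segment ℝ l m)).trans hgw⟩

end

section

variable {a b b' a' ι : Type} [Fintype a] [Fintype b] [Fintype b'] [Fintype a'] [Fintype ι]
  {E : BipartiteFunction}

/-! ### Pure states of bipartite systems -/

/-- The operator `|ψ⟩⟨ψ|` for the vector `ψ` with the matrix `M` of coefficients. -/
def pureOp (M : Matrix a b ℂ) : Matrix (a × b) (a × b) ℂ :=
  Matrix.of fun x y => M x.1 x.2 * star (M y.1 y.2)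

theorem pureOp_eq_vecMulVec (M : Matrix a b ℂ) :
    pureOp M = Matrix.vecMulVec (fun x : a × b => M x.1 x.2) (star fun x : a × b => M x.1 x.2) :=
  rfl

theorem actLeft_pureOp (L : Matrix a' a ℂ) (M : Matrix a b ℂ) :
    actLeft L (pureOp M) = pureOp (L * M) := by
  classical
  have h : (L ⊗ₖ (1 : Matrix b b ℂ)) *ᵥ (fun x : a × b => M x.1 x.2) =
      fun x : a' × b => (L * M) x.1 x.2 := by
    ext ⟨i, j⟩
    simp [Matrix.mulVec, dotProduct, Fintype.sum_prod_type, Matrix.mul_apply, Matrix.one_apply]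
  rw [actLeft, pureOp_eq_vecMulVec, pureOp_eq_vecMulVec, ← h, Matrix.mul_vecMulVec,
    Matrix.vecMulVec_mul, Matrix.star_mulVec]

theorem actRight_pureOp (L : Matrix b' b ℂ) (M : Matrix a b ℂ) :
    actRight L (pureOp M) = pureOp (M * Lᵀ) := by
  classical
  have h : ((1 : Matrix a a ℂ) ⊗ₖ L) *ᵥ (fun x : a × b => M x.1 x.2) =
      fun x : a × b' => (M * Lᵀ) x.1 x.2 := by
    ext ⟨i, j⟩
    simp [Matrix.mulVec, dotProduct, Fintype.sum_prod_type, Matrix.mul_apply, Matrix.one_apply,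
      mul_comm]
  rw [actRight, pureOp_eq_vecMulVec, pureOp_eq_vecMulVec, ← h, Matrix.mul_vecMulVec,
    Matrix.vecMulVec_mul, Matrix.star_mulVec]

theorem trace_pureOp (M : Matrix a b ℂ) : (pureOp M).trace = (Mᴴ * M).trace := by
  simp only [Matrix.trace, Matrix.diag, pureOp, Matrix.of_apply, Matrix.mul_apply,
    Matrix.conjTranspose_apply, Fintype.sum_prod_type]
  rw [Finset.sum_comm]
  simp only [mul_comm]

theorem posSemidef_pureOp (M : Matrix a b ℂ) : (pureOp M).PosSemidef :=
  Matrix.posSemidef_vecMulVec_self_star _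

theorem pureOp_smul (c : ℂ) (M : Matrix a b ℂ) :
    pureOp (c • M) = (c * star c) • pureOp M := by
  ext x y
  simp [pureOp]
  ring

theorem pureOp_zero : pureOp (0 : Matrix a b ℂ) = 0 := by
  ext x y
  simp [pureOp]

theorem State.exists_eq_sum_pureOp (ρ : State (a × b)) :
    ∃ M : a × b → Matrix a b ℂ, ρ.mat = ∑ l, pureOp (M l) := by
  classical
  obtain ⟨u, l, hl, h⟩ := ρ.exists_eq_sum_smul_ketbra
  refine ⟨fun k => ((√(l k) : ℝ) : ℂ) • Matrix.of fun i j => u k (i, j), ?_⟩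
  rw [h]
  refine Finset.sum_congr rfl fun k _ => ?_
  rw [pureOp_smul, RCLike.star_def, Complex.conj_ofReal, ← Complex.ofReal_mul,
    Real.mul_self_sqrt (hl k)]
  rfl

theorem ofReal_inv_sqrt_mul_star (x : ℕ) :
    ((√(x : ℝ) : ℝ) : ℂ)⁻¹ * star ((√(x : ℝ) : ℝ) : ℂ)⁻¹ = (x : ℂ)⁻¹ := by
  rw [star_inv₀, ← mul_inv, RCLike.star_def, Complex.conj_ofReal, ← Complex.ofReal_mul,
    Real.mul_self_sqrt (Nat.cast_nonneg _), Complex.ofReal_natCast]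

/-! ### The maximally entangled state -/

/-- The maximally entangled state of systems of dimensions `d` and at least `d`. -/
def maxEntangled [DecidableEq b] [Nonempty a] (φ : a ↪ b) : State (a × b) where
  mat := pureOp (((√(Fintype.card a) : ℝ) : ℂ)⁻¹ • Matrix.of fun i j => if φ i = j then 1 else 0)
  posSemidef := posSemidef_pureOp _
  trace_eq_one := by
    rw [pureOp_smul, Matrix.trace_smul, ofReal_inv_sqrt_mul_star]
    simp [pureOp, Matrix.trace, Matrix.diag, Fintype.sum_prod_type]

theorem maxEntangled_mat [DecidableEq b] [Nonempty a] (φ : a ↪ b) :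
    (maxEntangled φ).mat = pureOp (((√(Fintype.card a) : ℝ) : ℂ)⁻¹ •
      Matrix.of fun i j => if φ i = j then 1 else 0) := rfl

theorem maxEntangled_refl_mat [DecidableEq a] [Nonempty a] :
    (maxEntangled (Function.Embedding.refl a)).mat =
      pureOp (((√(Fintype.card a) : ℝ) : ℂ)⁻¹ • 1) := by
  rw [maxEntangled_mat]
  congr 2

/-- Diagonalise `G` and translate the eigenbasis by every element of the index group: each diagonal
entry then runs once through all the eigenvalues. The group structure only supplies these
translations. -/
theorem exists_sum_conj_eq_trace_smul_one [DecidableEq a] [AddCommGroup a] {G : Matrix a a ℂ}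
    (hG : G.IsHermitian) :
    ∃ U : a → Matrix a a ℂ, (∀ x, (U x)ᴴ * U x = 1) ∧ ∑ x, (U x)ᴴ * G * U x = G.trace • 1 := by
  let W : Matrix a a ℂ := hG.eigenvectorUnitary
  have hW : Wᴴ * W = 1 := Unitary.coe_star_mul_self hG.eigenvectorUnitary
  have hD : Wᴴ * G * W = Matrix.diagonal fun i => (hG.eigenvalues i : ℂ) := by
    have := hG.conjStarAlgAut_star_eigenvectorUnitary
    rw [Unitary.conjStarAlgAut_star_apply] at this
    exact this
  have hsub : ∀ (X : Matrix a a ℂ) (x : a),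
      (W.submatrix id (Equiv.addRight x))ᴴ * X * W.submatrix id (Equiv.addRight x) =
        (Wᴴ * X * W).submatrix (Equiv.addRight x) (Equiv.addRight x) := by
    intro X x
    ext i j
    simp [Matrix.mul_apply]
  refine ⟨fun x => W.submatrix id (Equiv.addRight x), fun x => ?_, ?_⟩
  · have := hsub 1 x
    rw [Matrix.mul_one, Matrix.mul_one, hW] at this
    rw [this]
    exact Matrix.submatrix_one_equiv _
  · simp only [hsub, hD]
    ext i j
    rw [Matrix.sum_apply, Matrix.smul_apply, Matrix.one_apply]
    by_cases hij : i = j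
    · subst hij
      simp only [Matrix.submatrix_apply, Matrix.diagonal_apply_eq, if_true, smul_eq_mul, mul_one,
        Equiv.coe_addRight]
      rw [hG.trace_eq_sum_eigenvalues]
      exact Equiv.sum_comp (Equiv.addLeft i) fun k => (hG.eigenvalues k : ℂ)
    · simp [hij]

theorem isKraus_iff [DecidableEq a] {K : ι → Matrix a' a ℂ} :
    IsKraus K ↔ ∑ k, (K k)ᴴ * K k = 1 := by
  rw [IsKraus]
  convert Iff.rfl

/-- Every state arises from the maximally entangled state by local operations and classical
communication. -/
theorem IsConvexEntanglementMonotone.le_maxEntangled (hE : IsConvexEntanglementMonotone E)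
    [DecidableEq a] [Nonempty a] [AddCommGroup a] (ρ : State (a × b)) :
    E a b ρ ≤ E a a (maxEntangled (Function.Embedding.refl a)) := by
  classical
  obtain ⟨M, hM⟩ := ρ.exists_eq_sum_pureOp
  have hG : ∀ l, ((M l)ᵀᴴ * (M l)ᵀ).IsHermitian := fun l =>
    Matrix.isHermitian_conjTranspose_mul_self _
  choose U hU hUG using fun l => exists_sum_conj_eq_trace_smul_one (hG l)
  -- `B` measures with `K` and announces `k`. The coefficient matrix becomes `(U k.1 k.2)ᵀ * M k.1`
  -- up to `1/√d`, with `d` the dimension of `a`, and `A` undoes the unitary factor with `V k`.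
  -- Averaging over the unitaries is what makes `K` complete.
  let K : (a × b) × a → Matrix b a ℂ := fun k => (M k.1)ᵀ * U k.1 k.2
  let V : (a × b) × a → Matrix a a ℂ := fun k => (U k.1 k.2)ᵀᴴ
  have hVU : ∀ k : (a × b) × a, V k * (U k.1 k.2)ᵀ = 1 := fun k => by
    have h := congrArg Matrix.transpose (mul_eq_one_comm.mp (hU k.1 k.2))
    rw [Matrix.transpose_mul, Matrix.transpose_one] at h
    exact h
  have hK : IsKraus K := by
    rw [isKraus_iff, Fintype.sum_prod_type]
    have h1 : ∀ l, ∑ x, (K (l, x))ᴴ * K (l, x) = (pureOp (M l)).trace • 1 := by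
      intro l
      have h2 : ((M l)ᵀᴴ * (M l)ᵀ).trace = (pureOp (M l)).trace := by
        rw [trace_pureOp, Matrix.trace_mul_comm (M l)ᴴ, ← Matrix.trace_transpose (M l * _),
          Matrix.transpose_mul]
        rfl
      rw [← h2, ← hUG l]
      refine Finset.sum_congr rfl fun x _ => ?_
      simp only [K, Matrix.conjTranspose_mul, Matrix.mul_assoc]
    simp only [h1]
    rw [← Finset.sum_smul, ← Matrix.trace_sum, ← hM, ρ.trace_eq_one, one_smul]
  have hV : ∀ k, IsKraus fun _ : Unit => V k := by
    intro k
    rw [isKraus_iff]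
    simp only [Finset.univ_unique, Finset.sum_singleton]
    have h := mul_eq_one_comm.mp (hVU k)
    rwa [← Matrix.conjTranspose_conjTranspose (U k.1 k.2)ᵀ] at h
  refine hE.mono a a a b _ (IsLOCC.right K hK (fun k X => ∑ _ : Unit, id (actLeft (V k) X))
    fun k => IsLOCC.left (fun _ => V k) (hV k) (fun _ => id) fun _ => IsLOCC.refl) _ _ ?_
  have h1 : ∀ k, actLeft (V k) (actRight (K k)
      (maxEntangled (Function.Embedding.refl a)).mat) =
        (Fintype.card a : ℂ)⁻¹ • pureOp (M k.1) := by
    intro k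
    rw [maxEntangled_refl_mat, actRight_pureOp, actLeft_pureOp]
    simp only [K, Matrix.transpose_mul, Matrix.transpose_transpose, Matrix.smul_mul,
      Matrix.mul_smul, Matrix.one_mul]
    rw [← Matrix.mul_assoc, hVU, Matrix.one_mul, pureOp_smul, ofReal_inv_sqrt_mul_star]
  simp only [Finset.univ_unique, Finset.sum_singleton, id, h1]
  rw [hM]
  symm
  rw [Fintype.sum_prod_type]
  refine Finset.sum_congr rfl fun l _ => ?_
  dsimp only
  -- Each `M l` is produced by `d` outcomes of weight `1/d`.
  rw [Finset.sum_const, Finset.card_univ, ← Nat.cast_smul_eq_nsmul ℂ, smul_smul,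
    mul_inv_cancel₀ (by simp), one_smul]

/-- The larger system `b` can be compressed onto the range of `φ`, which supports the whole reduced
state. -/
theorem IsConvexEntanglementMonotone.maxEntangled_refl_le (hE : IsConvexEntanglementMonotone E)
    [DecidableEq a] [DecidableEq b] [Nonempty a] (φ : a ↪ b) :
    E a a (maxEntangled (Function.Embedding.refl a)) ≤ E a b (maxEntangled φ) := by
  classical
  obtain ⟨a₀⟩ := ‹Nonempty a›
  let P : Matrix a b ℂ := Matrix.of fun i j => if φ i = j then 1 else 0
  -- Outcomes off the range of `φ`, sent to an arbitrary `a₀`. They complete the measurement and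
  -- have probability zero here.
  let Q : b → Matrix a b ℂ := fun y =>
    Matrix.of fun i j => if i = a₀ ∧ j = y ∧ y ∉ Set.range φ then 1 else 0
  let K : Option b → Matrix a b ℂ := fun o => o.elim P Q
  have hφP : ∀ k, P * (K k)ᵀ = if k = none then 1 else 0 := by
    rintro (_ | y)
    · ext i j
      simp [K, P, Matrix.mul_apply, Matrix.one_apply, eq_comm]
    · ext i j
      simp [K, P, Q, Matrix.mul_apply]
      refine Finset.sum_eq_zero fun z _ => ?_
      split_ifs with h h'
      · exact absurd (h'.trans h.2.1) (h.2.2 i)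
      · rfl
      · rfl
  have hK : IsKraus K := by
    rw [isKraus_iff, Fintype.sum_option]
    ext x y
    simp only [K, Option.elim, Matrix.add_apply, Matrix.sum_apply, Matrix.mul_apply,
      Matrix.conjTranspose_apply, P, Q, Matrix.of_apply, Matrix.one_apply]
    by_cases hx : x ∈ Set.range φ
    · obtain ⟨i, rfl⟩ := hx
      rw [Finset.sum_eq_single i, Finset.sum_eq_zero]
      · simp
      · intro z _
        refine Finset.sum_eq_zero fun k _ => ?_
        have : ¬ (k = a₀ ∧ φ i = z ∧ z ∉ Set.range φ) := fun h => h.2.2 ⟨i, h.2.1⟩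
        rw [if_neg this, star_zero, zero_mul]
      · intro j _ hj
        simp [φ.injective.ne hj]
      · simp
    · have hx' : ∀ i, φ i ≠ x := fun i hi => hx ⟨i, hi⟩
      rw [Finset.sum_eq_zero, Finset.sum_eq_single x, Finset.sum_eq_single a₀]
      · simp [hx', eq_comm]
      · intro i _ hi
        simp [hi]
      · simp
      · intro z _ hz
        refine Finset.sum_eq_zero fun k _ => ?_
        simp [hz.symm]
      · simp
      · intro i _
        simp [hx']
  refine hE.mono a b a a _ (IsLOCC.right K hK (fun _ => id) fun _ => IsLOCC.refl) _ _ ?_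
  have h1 : ∀ k, actRight (K k) (maxEntangled φ).mat =
      if k = none then (maxEntangled (Function.Embedding.refl a)).mat else 0 := by
    intro k
    rw [maxEntangled_refl_mat, maxEntangled_mat, actRight_pureOp, Matrix.smul_mul, hφP]
    split_ifs
    · rfl
    · rw [smul_zero, pureOp_zero]
  simp [h1]

/-- The largest value of an entanglement monotone is attained at the maximally entangled state. -/
theorem IsConvexEntanglementMonotone.exists_isGreatest (hE : IsConvexEntanglementMonotone E) :
    ∃ e : ℕ → ℝ, ∀ d₁ d₂ : ℕ, 0 < d₁ → d₁ ≤ d₂ →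
      IsGreatest (Set.range (E (Fin d₁) (Fin d₂))) (e d₁) := by
  classical
  refine ⟨fun d => if h : 0 < d then
    haveI : Nonempty (Fin d) := ⟨⟨0, h⟩⟩
    E (Fin d) (Fin d) (maxEntangled (Function.Embedding.refl _)) else 0, fun d₁ d₂ h₁ h₂ => ?_⟩
  -- Gives `Fin d₁` the additive group structure that `le_maxEntangled` requires.
  have : NeZero d₁ := ⟨h₁.ne'⟩
  simp only [h₁, dif_pos]
  refine ⟨⟨maxEntangled (Fin.castLEEmb h₂), le_antisymm (hE.le_maxEntangled _)
    (hE.maxEntangled_refl_le _)⟩, ?_⟩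
  rintro _ ⟨ρ, rfl⟩
  exact hE.le_maxEntangled ρ

end

section

variable {n a b : Type} [Fintype n] [Fintype a] [Fintype b]
  {C E : BipartiteFunction} {f : ProbVec → ℝ}

/-! ### Entanglement against correlation -/

/-- The values of `E` on the states with spectrum in a superlevel set of `f`. -/
def entanglementAbove (E : BipartiteFunction) (f : ProbVec → ℝ) (a b : Type) [Fintype a] [Fintype b]
    (x : ℝ) : Set ℝ :=
  E a b '' {ω | x ≤ f ω.spectrum}

theorem IsConvexEntanglementMonotone.convexOn_mixture (hE : IsConvexEntanglementMonotone E)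
    (u : OrthonormalBasis (a × b) ℂ (EuclideanSpace ℂ (a × b))) {g : (a × b → ℝ) → ℝ}
    (hg : ∀ l (hl : l ∈ stdSimplex ℝ (a × b)), g l = E a b (mixture u hl)) :
    ConvexOn ℝ (stdSimplex ℝ (a × b)) g := by
  refine ⟨convex_stdSimplex ℝ _, fun l hl m hm s t hs ht hst => ?_⟩
  have hlm := convex_stdSimplex ℝ _ hl hm hs ht hst
  obtain rfl : s = 1 - t := by linarith
  rw [hg l hl, hg m hm, hg _ hlm]
  refine hE.convex a b _ _ _ t ht (by linarith) ?_
  simp only [mixture, Finset.smul_sum, ← Finset.sum_add_distrib, smul_smul, ← add_smul]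
  refine Finset.sum_congr rfl fun k _ => ?_
  simp

/-- A state can be replaced by one with a prescribed smaller value of `f`, without decreasing its
entanglement. -/
theorem IsConvexEntanglementMonotone.exists_spectrum_eq (hE : IsConvexEntanglementMonotone E)
    (hf : ContinuousOn f (ProbVec.atMost (Fintype.card (a × b)))) (hf1 : f ProbVec.one = 0)
    {x : ℝ} (hx : 0 ≤ x) (ω : State (a × b)) (hω : x ≤ f ω.spectrum) :
    ∃ τ : State (a × b), f τ.spectrum = x ∧ E a b ω ≤ E a b τ := by
  classical
  obtain ⟨u, l, hl, rfl⟩ := ω.exists_eq_mixture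
  let g : (a × b → ℝ) → ℝ := fun l =>
    if h : l ∈ stdSimplex ℝ (a × b) then E a b (mixture u h) else 0
  let F : (a × b → ℝ) → ℝ := fun l =>
    if h : l ∈ stdSimplex ℝ (a × b) then f (mixture u h).spectrum else 0
  have hg : ∀ l (hl : l ∈ stdSimplex ℝ (a × b)), g l = E a b (mixture u hl) := fun l hl =>
    dif_pos hl
  have hF : ∀ l (hl : l ∈ stdSimplex ℝ (a × b)), F l = f (mixture u hl).spectrum := fun l hl =>
    dif_pos hl
  have hFc : ContinuousOn F (stdSimplex ℝ (a × b)) := by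
    rw [continuousOn_iff_continuous_domRestrict]
    refine Continuous.congr (hf.comp_continuous (continuous_spectrum_mixture u)
      fun l => State.spectrum_mem_atMost _) fun l => (hF l.1 l.2).symm
  obtain ⟨m, hm, hFm, hgm⟩ := exists_eq_and_le_of_convexOn_stdSimplex
    (hE.convexOn_mixture u hg) hFc (x := x) (fun k => by
      rw [hF _ (single_mem_stdSimplex ℝ k), spectrum_mixture_single, hf1]
      exact hx) l hl (by rwa [hF l hl])
  exact ⟨mixture u hm, by rw [← hF, hFm], by rwa [← hg, ← hg]⟩

theorem State.mat_of_spectrum_eq_uniform [DecidableEq n] (ω : State n) {d : ℕ} (hd : 0 < d)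
    (hn : Fintype.card n = d) (h : ω.spectrum = ProbVec.uniform d hd) :
    ω.mat = (d : ℂ)⁻¹ • 1 := by
  obtain ⟨u, l, hl, hω⟩ := ω.exists_eq_sum_smul_ketbra
  obtain ⟨τ, hτ⟩ := exists_equiv_antitone l
  have hs := ω.spectrum_val_of_antitone u hω τ hτ
  have hl : ∀ k, l k = (d : ℝ)⁻¹ := by
    intro k
    have h1 := hs (τ.symm k)
    rw [h, dif_pos (τ.symm k).2, Fin.eta, Equiv.apply_symm_apply] at h1
    rw [← h1]
    have h2 : (τ.symm k : ℕ) < d := hn ▸ (τ.symm k).2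
    simp [ProbVec.uniform, h2]
  rw [hω, ← sum_ketbra u, Finset.smul_sum]
  refine Finset.sum_congr rfl fun k _ => ?_
  rw [hl]
  push_cast
  rfl

/-- The maximally mixed state. -/
def maxMixed (n : Type) [Fintype n] [DecidableEq n] [Nonempty n] : State n where
  mat := (Fintype.card n : ℂ)⁻¹ • 1
  posSemidef := Matrix.PosSemidef.one.smul (by
    rw [← Complex.ofReal_natCast, ← Complex.ofReal_inv]
    exact_mod_cast inv_nonneg.mpr (Nat.cast_nonneg _))
  trace_eq_one := by simp [Matrix.trace_smul]

theorem isSeparable_of_mat_eq_smul_one [DecidableEq a] [DecidableEq b] [Nonempty a] [Nonempty b]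
    (ω : State (a × b)) {d : ℕ} (hd : Fintype.card a * Fintype.card b = d)
    (h : ω.mat = (d : ℂ)⁻¹ • 1) : IsSeparable ω := by
  refine ⟨1, fun _ => 1, fun _ => maxMixed a, fun _ => maxMixed b, by simp, by simp, ?_⟩
  simp only [Finset.univ_unique, Finset.sum_const, Finset.card_singleton, one_smul,
    Complex.ofReal_one, maxMixed]
  rw [h, ← hd, Matrix.smul_kronecker, Matrix.kronecker_smul, Matrix.one_kronecker_one, smul_smul]
  push_cast
  rw [mul_inv]

end

end QCorr

end

/-! ### The trade-off between entanglement and correlation -/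

theorem mainTheorem4 (C : QCorr.BipartiteFunction) (hC : QCorr.IsCorrelationMonotone C) :
    ∃ f : QCorr.ProbVec → ℝ,
      f QCorr.ProbVec.one = 0 ∧
      (∀ (a b : Type) [Fintype a] [Fintype b] (ρ : QCorr.State (a × b)),
        QCorr.IsClassicalClassical ρ → C a b ρ ≤ f ρ.reduceLeft.spectrum) ∧
      (∀ (a b : Type) [Fintype a] [Fintype b] (ρ : QCorr.State (a × b)),
        QCorr.IsStrictlyCorrelated ρ → C a b ρ = f ρ.reduceLeft.spectrum) ∧
      ∀ E : QCorr.BipartiteFunction, QCorr.IsConvexEntanglementMonotone E →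
        ∃ e : ℕ → ℝ,
          (∀ d₁ d₂ : ℕ, 0 < d₁ → d₁ ≤ d₂ →
            IsGreatest (Set.range (E (Fin d₁) (Fin d₂))) (e d₁)) ∧
          ∀ (d₁ d₂ : ℕ) (hd₁ : 0 < d₁) (hd₂ : d₁ ≤ d₂),
            ContinuousOn f (QCorr.ProbVec.atMost (d₁ * d₂)) →
            ∃ c : ℝ, IsGreatest (f '' QCorr.ProbVec.atMost (d₁ * d₂)) c ∧
            ∃ ζ : ℝ → ℝ,
              AntitoneOn ζ (Set.Icc 0 c) ∧
              ζ 0 = e d₁ ∧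
              (∀ (b : Type) [Fintype b] (ρ : QCorr.State ((Fin d₁ × Fin d₂) × b)),
                QCorr.IsClassicalClassical ρ →
                  C (Fin d₁ × Fin d₂) b ρ ∈ Set.Icc 0 c ∧
                  E (Fin d₁) (Fin d₂) ρ.reduceLeft ≤ ζ (C (Fin d₁ × Fin d₂) b ρ)) ∧
              (∀ x ∈ Set.Icc 0 c, ∀ η : ℝ, 0 < η →
                ∃ (b : Type) (_ : Fintype b) (ρ : QCorr.State ((Fin d₁ × Fin d₂) × b)),
                  QCorr.IsClassicalClassical ρ ∧ C (Fin d₁ × Fin d₂) b ρ = x ∧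
                  ζ x - E (Fin d₁) (Fin d₂) ρ.reduceLeft < η) ∧
              (f (QCorr.ProbVec.uniform (d₁ * d₂)
                    (Nat.mul_pos hd₁ (hd₁.trans_le hd₂))) = c →
                (∀ p ∈ QCorr.ProbVec.atMost (d₁ * d₂),
                  p ≠ QCorr.ProbVec.uniform (d₁ * d₂)
                    (Nat.mul_pos hd₁ (hd₁.trans_le hd₂)) → f p < c) →
                ζ c = 0) := by
  classical
  obtain ⟨f, hf1, hf0, hle, heq⟩ := hC.exists_spectral_bound
  refine ⟨f, hf1, hle, heq, fun E hE => ?_⟩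
  obtain ⟨e, he⟩ := hE.exists_isGreatest
  refine ⟨e, he, fun d₁ d₂ hd₁ hd₂ hf => ?_⟩
  have hd : 0 < d₁ * d₂ := Nat.mul_pos hd₁ (hd₁.trans_le hd₂)
  have hcard : Fintype.card (Fin d₁ × Fin d₂) = d₁ * d₂ := by simp
  have hspec : ∀ ω : QCorr.State (Fin d₁ × Fin d₂),
      ω.spectrum ∈ QCorr.ProbVec.atMost (d₁ * d₂) := fun ω => hcard ▸ ω.spectrum_mem_atMost
  have hunif : QCorr.ProbVec.uniform (d₁ * d₂) hd ∈ QCorr.ProbVec.atMost (d₁ * d₂) :=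
    fun i hi => if_neg (not_lt.mpr hi)
  obtain ⟨p, hp, hpmax⟩ := (QCorr.ProbVec.isCompact_atMost (d₁ * d₂)).exists_isMaxOn ⟨_, hunif⟩ hf
  have hfle : ∀ ω : QCorr.State (Fin d₁ × Fin d₂), f ω.spectrum ≤ f p := fun ω => hpmax (hspec ω)
  -- Using `x ≤ f` rather than `f = x` makes monotonicity automatic; the convexity argument recovers
  -- equality.
  let ζ : ℝ → ℝ := fun x => sSup (QCorr.entanglementAbove E f (Fin d₁) (Fin d₂) x)
  have hbdd : ∀ x, BddAbove (QCorr.entanglementAbove E f (Fin d₁) (Fin d₂) x) := fun x =>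
    ⟨e d₁, by rintro _ ⟨ω, -, rfl⟩; exact (he d₁ d₂ hd₁ hd₂).2 ⟨ω, rfl⟩⟩
  have hne : ∀ x ≤ f p, (QCorr.entanglementAbove E f (Fin d₁) (Fin d₂) x).Nonempty := by
    intro x hx
    obtain ⟨ω, rfl⟩ := QCorr.exists_spectrum_eq (n := Fin d₁ × Fin d₂) (hcard.symm ▸ hp)
    exact ⟨_, ω, hx, rfl⟩
  refine ⟨f p, ⟨⟨p, hp, rfl⟩, ?_⟩, ζ, ?_, ?_, ?_, ?_, ?_⟩
  · rintro _ ⟨q, hq, rfl⟩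
    exact hpmax hq
  · intro x _ y hy hxy
    exact csSup_le_csSup (hbdd x) (hne y hy.2)
      (Set.image_mono fun ω (hω : y ≤ f ω.spectrum) => hxy.trans hω)
  · have h : QCorr.entanglementAbove E f (Fin d₁) (Fin d₂) 0 =
        Set.range (E (Fin d₁) (Fin d₂)) := by
      rw [← Set.image_univ, QCorr.entanglementAbove]
      congr 1
      exact Set.eq_univ_of_forall fun ω => hf0 _
    simp only [ζ, h]
    exact (he d₁ d₂ hd₁ hd₂).csSup_eq
  · intro b _ ρ hρ
    have h := hle _ _ ρ hρ
    exact ⟨⟨hC.nonneg _ _ _, h.trans (hfle _)⟩, le_csSup (hbdd _) ⟨_, h, rfl⟩⟩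
  · intro x hx η hη
    -- The supremum need not be attained, hence the margin `η`. The near-optimal `ω` is moved to the
    -- level `x` and then extended to a strictly correlated state, for which `C` equals `f`.
    obtain ⟨_, ⟨ω, hω, rfl⟩, hωη⟩ := exists_lt_of_lt_csSup (hne x hx.2) (sub_lt_self (ζ x) hη)
    obtain ⟨τ, hτ, hE'⟩ := hE.exists_spectrum_eq (hcard.symm ▸ hf) hf1 hx.1 ω hω
    obtain ⟨ρ, hρ, rfl⟩ := τ.exists_isStrictlyCorrelated
    exact ⟨_, inferInstance, ρ, hρ.isClassicalClassical, (heq _ _ ρ hρ).trans hτ, by linarith⟩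
  · intro hu hlt
    have : Nonempty (Fin d₁) := ⟨⟨0, hd₁⟩⟩
    have : Nonempty (Fin d₂) := ⟨⟨0, hd₁.trans_le hd₂⟩⟩
    have h : QCorr.entanglementAbove E f (Fin d₁) (Fin d₂) (f p) = {0} := by
      refine (Set.Nonempty.subset_singleton_iff (hne _ le_rfl)).mp ?_
      rintro _ ⟨ω, hω, rfl⟩
      have hω' : ω.spectrum = QCorr.ProbVec.uniform (d₁ * d₂) hd := by
        by_contra hcon
        exact absurd (hlt _ (hspec ω) hcon) (not_lt.mpr hω)
      exact hE.separable _ _ _ (QCorr.isSeparable_of_mat_eq_smul_one ω (by simp)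
        (ω.mat_of_spectrum_eq_uniform hd hcard hω'))
    simp only [ζ, h, csSup_singleton]
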